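/- Let $d\ge 1$ and let $U:\mathbb{R}^d\to\mathbb{R}$ be continuously differentiable. Assume that there are $L\ge 0$ and $m>0$ such that for all $x,y\in\mathbb{R}^d$ $$\|\nabla U(x)-\nabla U(y)\|\le L\|x-y\|,\qquad U(y)\ge U(x)+\langle\nabla U(x),y-x\rangle+\tfrac m2\|y-x\|^2 .$$ Put $\kappa=2mL/(m+L)$ and let $\mathbf{\Phi}$ be the cumulative distribution function of the standard normal distribution. For $\gamma>0$ let $R_\gamma$ be the Markov kernel $$R_\gamma(x,A)=\int_A(4\pi\gamma)^{-d/2}\exp\Big(-\frac{\|y-x+\gamma\nabla U(x)\|^2}{4\gamma}\Big)\,\mathrm{d}y ,$$ and for a nonincreasing sequence $(\gamma_k)_{k\ge1}$ of positive step sizes and $1\le n<\ell$ let $$Q_\gamma^{n,\ell}=R_{\gamma_n}R_{\gamma_{n+1}}\cdots R_{\gamma_\ell},\qquad \Lambda_{n,\ell}(\gamma)=\kappa^{-1}\Big\{\prod_{j=n}^{\ell}(1-\kappa\gamma_j)^{-1}-1\Big\},$$ where $\Lambda_{n,\ell}(\gamma)=+\infty$ if some factor $1-\kappa\gamma_j$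 is $0$ (the right-hand sides in (i) and (ii) are then $0$). Let $\|\mu-\nu\|_{\mathrm{TV}}=\sup_A|\mu(A)-\nu(A)|$, the supremum being over Borel sets, let $\mathcal{P}_1(\mathbb{R}^d)$ be the set of probability measures on $\mathbb{R}^d$ with finite first moment, and let $W_1(\mu,\nu)=\inf_\zeta\int\|x-y\|\,\mathrm{d}\zeta(x,y)$, the infimum being over the couplings $\zeta$ of $\mu$ and $\nu$. (i) Let $(\gamma_k)_{k\ge1}$ be a nonincreasing sequence of positive numbers with $\gamma_1\le 2/(m+L)$. For all $x,y\in\mathbb{R}^d$ and all integers $1\le n<\ell$, $$\|\delta_xQ_\gamma^{n,\ell}-\delta_yQ_\gamma^{n,\ell}\|_{\mathrm{TV}}\le 1-2\mathbf{\Phi}\big\{-\|x-y\|/\{8\Lambda_{n,\ell}(\gamma)\}^{1/2}\big\}.$$ (ii) Let $(\gamma_k)_{k\ge1}$ be a nonincreasing sequence of positive numbers with $\gamma_1\le 2/(m+L)$. For all $\mu,\nu\in\mathcal{P}_1(\mathbb{R}^d)$ and all integers $1\le n<\ell$, $$\|\mu Q_\gamma^{n,\ell}-\nu Q_\gamma^{n,\ell}\|_{\mathrm{TV}}\le\{4\pi\Lambda_{n,\ell}(\gamma)\}^{-1/2}\,W_1(\mu,\nu).$$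 (iii) $U$ has a unique minimizer $x^\star$, and for every $\gamma\in(0,2/(m+L)]$ the kernel $R_\gamma$ has a unique invariant probability measure $\pi_\gamma$. For all $x\in\mathbb{R}^d$ and all integers $n\ge1$, $$\|\pi_\gamma-\delta_xR_\gamma^n\|_{\mathrm{TV}}\le\{4\pi\kappa^{-1}(1-(1-\kappa\gamma)^{n/2})\}^{-1/2}(1-\kappa\gamma)^{n/2}\big\{\|x-x^\star\|+(2\kappa^{-1}d)^{1/2}\big\}.$$ -/

import Mathlib

open MeasureTheory ProbabilityTheory Set

namespace ULA

noncomputable section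

/-- The gradient of a real function on a Euclidean space is measurable. -/
theorem measurable_gradient {d : ℕ} (U : EuclideanSpace ℝ (Fin d) → ℝ) :
    Measurable (gradient U) :=
  (InnerProductSpace.toDual ℝ (EuclideanSpace ℝ (Fin d))).symm.continuous.measurable.comp
    (measurable_fderiv ℝ U)

/-- `U` is continuously differentiable and its gradient is `L`-Lipschitz, `L ≥ 0`. -/
def GradientLipschitz {d : ℕ} (U : EuclideanSpace ℝ (Fin d) → ℝ) (L : ℝ) : Prop :=
  ContDiff ℝ 1 U ∧ 0 ≤ L ∧ ∀ x y, ‖gradient U x - gradient U y‖ ≤ L * ‖x - y‖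

/-- `U` (differentiable) is strongly convex with constant `m > 0`. -/
def StronglyConvex {d : ℕ} (U : EuclideanSpace ℝ (Fin d) → ℝ) (m : ℝ) : Prop :=
  0 < m ∧ ∀ x y, U x + inner ℝ (gradient U x) (y - x) + (m / 2) * ‖y - x‖ ^ 2 ≤ U y

/-- The constant `κ = 2mL/(m+L)`. -/
def kappa (m L : ℝ) : ℝ := 2 * m * L / (m + L)

/-- The density `y ↦ (4πγ)^(-d/2) exp (-‖y - x + γ ∇U(x)‖² / (4γ))` of one Euler step from `x`
with step size `γ > 0`, i.e. of the law `N(x - γ ∇U(x), 2γ Id)`. -/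
def eulerDensity {d : ℕ} (U : EuclideanSpace ℝ (Fin d) → ℝ) (γ : ℝ)
    (x y : EuclideanSpace ℝ (Fin d)) : ℝ :=
  (4 * Real.pi * γ) ^ (-(d : ℝ) / 2) * Real.exp (-‖y - x + γ • gradient U x‖ ^ 2 / (4 * γ))

theorem measurable_eulerDensity {d : ℕ} (U : EuclideanSpace ℝ (Fin d) → ℝ) (γ : ℝ) :
    Measurable (Function.uncurry (eulerDensity U γ)) := by
  have h := measurable_gradient U
  unfold Function.uncurry eulerDensity
  fun_prop

/-- The Markov kernel `R_γ` of the Euler discretization (unadjusted Langevin algorithm),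
`R_γ(x, A) = ∫_A (4πγ)^(-d/2) exp (-‖y - x + γ ∇U(x)‖² / (4γ)) dy`. -/
def eulerKernel {d : ℕ} (U : EuclideanSpace ℝ (Fin d) → ℝ) (γ : ℝ) :
    Kernel (EuclideanSpace ℝ (Fin d)) (EuclideanSpace ℝ (Fin d)) where
  toFun x := volume.withDensity fun y => ENNReal.ofReal (eulerDensity U γ x y)
  measurable' := by
    refine Measure.measurable_of_measurable_coe _ fun s hs => ?_
    simp_rw [withDensity_apply _ hs]
    exact (measurable_eulerDensity U γ).ennreal_ofReal.lintegral_prod_right'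

/-- `Q_γ^{n,ℓ} = R_{γ_n} R_{γ_{n+1}} ⋯ R_{γ_ℓ}` for `1 ≤ n ≤ ℓ` (the kernel `R_{γ_n}` acts first),
and the identity kernel when `ℓ < n`. -/
def eulerChain {d : ℕ} (U : EuclideanSpace ℝ (Fin d) → ℝ) (γ : ℕ → ℝ) (n : ℕ) :
    ℕ → Kernel (EuclideanSpace ℝ (Fin d)) (EuclideanSpace ℝ (Fin d))
  | 0 => Kernel.id
  | ℓ + 1 => if n ≤ ℓ + 1 then eulerKernel U (γ (ℓ + 1)) ∘ₖ eulerChain U γ n ℓ else Kernel.id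

/-- `Λ_{n,ℓ}(γ) = κ⁻¹ (∏_{j=n}^ℓ (1 - κ γ_j)⁻¹ - 1)`. -/
def Lam (κ : ℝ) (γ : ℕ → ℝ) (n ℓ : ℕ) : ℝ :=
  κ⁻¹ * (∏ j ∈ Finset.Icc n ℓ, (1 - κ * γ j)⁻¹ - 1)

/-- Total variation distance of two probability measures, `sup_A |μ(A) - ν(A)|`. -/
def tvDist {E : Type*} [MeasurableSpace E] (μ ν : Measure E) : ℝ :=
  ⨆ A : {A : Set E // MeasurableSet A}, |μ.real A - ν.real A|

/-- Probability measures with finite first moment. -/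
def InP1 {d : ℕ} (μ : Measure (EuclideanSpace ℝ (Fin d))) : Prop :=
  IsProbabilityMeasure μ ∧ Integrable (fun x => ‖x‖) μ

/-- The Wasserstein distance `W_1(μ, ν)`: the infimum of `∫ ‖x - y‖ dζ(x, y)` over all couplings
`ζ` of `μ` and `ν` (finite when `μ` and `ν` have finite first moments). -/
def W1 {d : ℕ} (μ ν : Measure (EuclideanSpace ℝ (Fin d))) : ℝ :=
  (⨅ ζ ∈ {ζ : Measure (EuclideanSpace ℝ (Fin d) × EuclideanSpace ℝ (Fin d)) |
      ζ.map Prod.fst = μ ∧ ζ.map Prod.snd = ν},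
    ∫⁻ p, ENNReal.ofReal ‖p.1 - p.2‖ ∂ζ).toReal

/-- The cumulative distribution function of the standard normal distribution. -/
def Phi (s : ℝ) : ℝ := cdf (gaussianReal 0 1) s

/-- A sequence of positive step sizes `γ_1 ≥ γ_2 ≥ ⋯` (the value `γ 0` plays no role) with
`γ_1 ≤ c`. -/
def StepSizes (γ : ℕ → ℝ) (c : ℝ) : Prop :=
  (∀ k, 1 ≤ k → 0 < γ k) ∧ (∀ k, 1 ≤ k → γ (k + 1) ≤ γ k) ∧ γ 1 ≤ c

end

end ULA

/-!
The proof of (i) replaces the coupling of two trajectories by a direct estimate of the functions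
`x ↦ Q(x, A)`. Write `gaussianSign v r = E[sign (r + √v Z)]` with `Z` standard normal, an odd
nondecreasing function of `r` equal to `1 - 2Φ(-r/√v)` for `v > 0` and to the sign of `r` for `v = 0`.
An indicator function `g` satisfies `|g x - g y| ≤ gaussianSign 0 ‖x - y‖`, and each Euler step
improves a modulus of continuity of the form `gaussianSign w`:

* Convolution with `N(0, 2γ Id)` turns the modulus `gaussianSign w` into `gaussianSign (w + 8γ)`
  (`integral_isoGaussian_sub_le`). The difference of the integrals of `g` against `N(a, 2γ Id)` and
  `N(b, 2γ Id)` is antisymmetrized under the reflection that exchanges `a` and `b`. The difference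
  of the two densities is odd under this reflection and has a sign on each side of the mirror, while
  `g` differs at a point and at its mirror image by at most `gaussianSign w` of their distance. What
  remains is a one-dimensional integral, evaluated by the semigroup property of Gaussian laws
  (`integral_gaussianSign`).
* The drift `x ↦ x - γ ∇U(x)` contracts squared distances by `1 - κγ`
  (`norm_gradient_step_sub_sq_le`), which, by scaling, divides the variance parameter by `1 - κγ`.

Iterating `w ↦ (w + 8γ) / (1 - κγ)` backwards along the chain from `w = 0` gives the variance
parameter `8 Λ`, which is (i). Part (ii) integrates the linear bound
`gaussianSign v r ≤ 2r / √(2πv)` against a coupling.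

For (iii), the linear bound makes the laws `R_γ^n(x⋆, ·)` Cauchy, uniformly over events, with
geometric rate (`exists_invariant`). Probability measures are complete for this convergence
(`exists_setwise_limit`). The limit is invariant and its second moment about the minimizer `x⋆` is
at most `2d/κ`, both by Fatou's inequality for setwise convergence (`lintegral_le_of_setwise`), so its
mean distance to a point `x` is at most `‖x - x⋆‖ + √(2d/κ)`. The convergence of `R_γ^n(x, ·)` to it
from every `x` gives uniqueness.
-/

namespace ULA

open Filter Topology
open scoped NNReal ENNReal

/-! ### The Gaussian sign function -/

/-- `E[sign (r + √v Z)]` for a standard normal variable `Z`. For `r ≥ 0` this is the total variation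
distance of two isotropic Gaussians whose means are at distance `r` and whose common covariance is
`(v / 4) Id`; the variance `v = 0`, where it is the sign of `r`, is allowed. -/
noncomputable def gaussianSign (v : ℝ≥0) (r : ℝ) : ℝ := ∫ z, Real.sign z ∂gaussianReal r v

theorem monotone_sign : Monotone Real.sign := by
  intro a b hab
  unfold Real.sign
  split_ifs <;> norm_num <;> linarith

theorem measurable_sign_comp {α : Type*} [MeasurableSpace α] {f : α → ℝ} (hf : Measurable f) :
    Measurable fun x => Real.sign (f x) :=
  monotone_sign.measurable.comp hf

theorem abs_sign_le_one (z : ℝ) : |Real.sign z| ≤ 1 := by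
  rcases Real.sign_apply_eq z with h | h | h <;> simp [h]

theorem integrable_of_abs_le {α : Type*} [MeasurableSpace α] {μ : Measure α} [IsFiniteMeasure μ]
    {f : α → ℝ} (hf : Measurable f) {C : ℝ} (hC : ∀ x, |f x| ≤ C) : Integrable f μ :=
  Integrable.of_bound hf.aestronglyMeasurable C (Eventually.of_forall hC)

theorem gaussianSign_eq_integral_add (v : ℝ≥0) (r : ℝ) :
    gaussianSign v r = ∫ z, Real.sign (r + z) ∂gaussianReal 0 v := by
  have h := gaussianReal_map_const_add (μ := 0) (v := v) r
  rw [zero_add] at h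
  rw [gaussianSign, ← h, integral_map (by fun_prop)
    monotone_sign.measurable.aestronglyMeasurable]

theorem monotone_gaussianSign (v : ℝ≥0) : Monotone (gaussianSign v) := by
  intro a b hab
  simp_rw [gaussianSign_eq_integral_add]
  exact integral_mono
    (integrable_of_abs_le (measurable_sign_comp (by fun_prop)) fun _ => abs_sign_le_one _)
    (integrable_of_abs_le (measurable_sign_comp (by fun_prop)) fun _ => abs_sign_le_one _)
    fun z => monotone_sign (by linarith)

theorem gaussianSign_neg (v : ℝ≥0) (r : ℝ) : gaussianSign v (-r) = -gaussianSign v r := by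
  rw [gaussianSign, ← gaussianReal_map_neg, integral_map (by fun_prop)
    monotone_sign.measurable.aestronglyMeasurable, gaussianSign]
  simp_rw [Real.sign_neg, integral_neg]

theorem gaussianSign_zero_right (v : ℝ≥0) : gaussianSign v 0 = 0 := by
  have := gaussianSign_neg v 0
  rw [neg_zero] at this
  linarith

theorem abs_gaussianSign_le_one (v : ℝ≥0) (r : ℝ) : |gaussianSign v r| ≤ 1 := by
  have := norm_integral_le_of_norm_le_const (μ := gaussianReal r v)
    (Eventually.of_forall fun z => (Real.norm_eq_abs _).trans_le (abs_sign_le_one z))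
  simpa [gaussianSign] using this

theorem gaussianSign_zero_left (r : ℝ) : gaussianSign 0 r = Real.sign r := by
  simp [gaussianSign]

theorem gaussianSign_scale (v : ℝ≥0) (r : ℝ) {c : ℝ≥0} (hc : 0 < c) :
    gaussianSign (c ^ 2 * v) (c * r) = gaussianSign v r := by
  have h := gaussianReal_map_const_mul (μ := r) (v := v) c
  have h3 : NNReal.mk ((c : ℝ) ^ 2) (sq_nonneg _) = c ^ 2 := rfl
  rw [h3] at h
  rw [gaussianSign, ← h, integral_map (by fun_prop)
    monotone_sign.measurable.aestronglyMeasurable, gaussianSign]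
  refine integral_congr_ae (Eventually.of_forall fun z => ?_)
  have hc' : (0 : ℝ) < c := hc
  rcases lt_trichotomy z 0 with hz | hz | hz
  · simp [Real.sign_of_neg hz, Real.sign_of_neg (mul_neg_of_pos_of_neg hc' hz)]
  · simp [hz]
  · simp [Real.sign_of_pos hz, Real.sign_of_pos (mul_pos hc' hz)]

/-- The semigroup property of the Gaussian distribution: the variances add up. -/
theorem integral_gaussianSign (v w : ℝ≥0) (r : ℝ) :
    ∫ t, gaussianSign v t ∂gaussianReal r w = gaussianSign (v + w) r := by
  have h := gaussianReal_conv_gaussianReal (m₁ := r) (m₂ := 0) (v₁ := w) (v₂ := v)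
  rw [add_zero, add_comm w v] at h
  rw [gaussianSign, ← h, integral_conv]
  · simp_rw [gaussianSign_eq_integral_add]
  · exact integrable_of_abs_le monotone_sign.measurable abs_sign_le_one

theorem gaussianSign_eq_one_sub (v : ℝ≥0) (hv : 0 < v) (r : ℝ) :
    gaussianSign v r = 1 - 2 * Phi (-(r / √v)) := by
  have hs : 0 < NNReal.sqrt v := by simpa using hv
  have hs' : (0 : ℝ) < √v := by simpa using hv
  have h := gaussianSign_scale 1 (r / √v) hs
  rw [mul_one, NNReal.sq_sqrt, Real.coe_sqrt, mul_div_cancel₀ _ hs'.ne'] at h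
  rw [h]
  generalize r / √v = s
  rw [gaussianSign_eq_integral_add, Phi, cdf_eq_real]
  have : (fun z => Real.sign (s + z)) =ᵐ[gaussianReal 0 1]
      fun z => 1 - 2 * (Iic (-s)).indicator (fun _ => (1 : ℝ)) z := by
    have h0 : ∀ᵐ z ∂gaussianReal 0 1, z ≠ -s := by
      have := nullSingletonClass_gaussianReal (μ := 0) (v := 1) one_ne_zero
      simp [ae_iff]
    filter_upwards [h0] with z hz
    rcases lt_or_gt_of_ne hz with h | h
    · rw [Real.sign_of_neg (by linarith), indicator_of_mem (show z ∈ Iic (-s) from h.le)]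
      norm_num
    · rw [Real.sign_of_pos (by linarith), indicator_of_notMem (by simpa using h)]
      norm_num
  rw [integral_congr_ae this, integral_sub (integrable_const _), integral_const_mul,
    integral_indicator_const _ measurableSet_Iic]
  · simp
  · exact ((integrable_const _).indicator measurableSet_Iic).const_mul _

theorem gaussianSign_le (v : ℝ≥0) (hv : 0 < v) {r : ℝ} (hr : 0 ≤ r) :
    gaussianSign v r ≤ 2 * r / √(2 * Real.pi * v) := by
  -- By symmetry `gaussianSign v r` is at most the mass of `[-r, r]`.
  have hsym : gaussianSign v r
      = ∫ z, (Real.sign (r + z) + Real.sign (r - z)) / 2 ∂gaussianReal 0 v := by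
    have h1 := gaussianSign_eq_integral_add v r
    have h2 : gaussianSign v r = ∫ z, Real.sign (r - z) ∂gaussianReal 0 v := by
      have h3 := gaussianReal_map_neg (μ := 0) (v := v)
      rw [neg_zero] at h3
      rw [h1]
      conv_lhs => rw [← h3]
      rw [integral_map (by fun_prop) (measurable_sign_comp (by fun_prop)).aestronglyMeasurable]
      simp_rw [sub_eq_add_neg]
    rw [integral_div, integral_add, ← h1, ← h2]
    · ring
    · exact integrable_of_abs_le (measurable_sign_comp (by fun_prop))
        fun _ => abs_sign_le_one _
    · exact integrable_of_abs_le (measurable_sign_comp (by fun_prop))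
        fun _ => abs_sign_le_one _
  have hmass : gaussianSign v r ≤ (gaussianReal 0 v).real (Icc (-r) r) := by
    rw [hsym, ← integral_indicator_one measurableSet_Icc]
    refine integral_mono ?_ ((integrable_const _).indicator measurableSet_Icc) fun z => ?_
    · refine integrable_of_abs_le (C := 1) (Measurable.div_const (Measurable.add
        (measurable_sign_comp (by fun_prop))
        (measurable_sign_comp (by fun_prop))) _) fun z => ?_
      have h1 := abs_le.1 (abs_sign_le_one (r + z))
      have h2 := abs_le.1 (abs_sign_le_one (r - z))
      exact abs_le.2 ⟨by linarith, by linarith⟩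
    · have h1 := abs_le.1 (abs_sign_le_one (r + z))
      have h2 := abs_le.1 (abs_sign_le_one (r - z))
      by_cases hz : z ∈ Icc (-r) r
      · simp only [indicator_of_mem hz, Pi.one_apply]
        linarith
      · simp only [indicator_of_notMem hz]
        rw [mem_Icc, not_and_or, not_le, not_le] at hz
        rcases hz with hz | hz
        · rw [Real.sign_of_neg (show r + z < 0 by linarith)]
          linarith
        · rw [Real.sign_of_neg (show r - z < 0 by linarith)]
          linarith
  refine hmass.trans ?_
  rw [measureReal_def, gaussianReal_apply_eq_integral _ hv.ne', ENNReal.toReal_ofReal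
    (integral_nonneg fun x => gaussianPDFReal_nonneg _ _ _)]
  have hle : ∀ x, gaussianPDFReal 0 v x ≤ (√(2 * Real.pi * v))⁻¹ := fun x => by
    unfold gaussianPDFReal
    refine mul_le_of_le_one_right (by positivity) (Real.exp_le_one_iff.2 ?_)
    rw [neg_div]
    exact neg_nonpos.2 (by positivity)
  calc ∫ x in Icc (-r) r, gaussianPDFReal 0 v x
      ≤ ∫ x in Icc (-r) r, (√(2 * Real.pi * v))⁻¹ :=
        setIntegral_mono (integrable_gaussianPDFReal _ _).integrableOn
          (integrableOn_const (by simp)) hle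
    _ = 2 * r / √(2 * Real.pi * v) := by
        simp [hr]
        field_simp
        ring

/-! ### Isotropic Gaussian measures -/

section Gaussian

variable {d : ℕ}

local notation "E" => EuclideanSpace ℝ (Fin d)

/-- The density of `N(0, 2γ Id)` with respect to Lebesgue measure. -/
noncomputable def isoDensity (γ : ℝ) (u : EuclideanSpace ℝ (Fin d)) : ℝ :=
  (4 * Real.pi * γ) ^ (-(d : ℝ) / 2) * Real.exp (-‖u‖ ^ 2 / (4 * γ))

/-- The Gaussian measure `N(a, 2γ Id)`. -/
noncomputable def isoGaussian (γ : ℝ) (a : EuclideanSpace ℝ (Fin d)) :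
    Measure (EuclideanSpace ℝ (Fin d)) :=
  volume.withDensity fun y => ENNReal.ofReal (isoDensity γ (y - a))

theorem eulerKernel_apply (U : E → ℝ) (γ : ℝ) (x : E) :
    eulerKernel U γ x = isoGaussian γ (x - γ • gradient U x) := by
  change volume.withDensity _ = volume.withDensity _
  congr 1
  funext y
  rw [eulerDensity, isoDensity, sub_sub_eq_add_sub, sub_add_eq_add_sub]

theorem isoDensity_nonneg {γ : ℝ} (hγ : 0 < γ) (u : E) : 0 ≤ isoDensity γ u := by
  unfold isoDensity
  positivity

theorem continuous_isoDensity (γ : ℝ) : Continuous (isoDensity γ : E → ℝ) := by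
  unfold isoDensity
  fun_prop

theorem integrable_isoDensity {γ : ℝ} (hγ : 0 < γ) : Integrable (isoDensity γ : E → ℝ) := by
  have h := (GaussianFourier.integrable_cexp_neg_mul_sq_norm_add (V := E) (b := ((4 * γ)⁻¹ : ℝ))
    (by simp only [Complex.ofReal_re]; positivity) 0 0).norm
  refine (h.const_mul ((4 * Real.pi * γ) ^ (-(d : ℝ) / 2))).congr (Eventually.of_forall fun u => ?_)
  simp only [Complex.norm_exp, isoDensity]
  congr 2
  have : -(((4 * γ)⁻¹ : ℝ) : ℂ) * (‖u‖ : ℂ) ^ 2 + 0 * ((inner ℝ (0 : E) u : ℝ) : ℂ)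
    = ((-((4 * γ)⁻¹) * ‖u‖ ^ 2 : ℝ) : ℂ) := by push_cast; ring
  rw [this, Complex.ofReal_re]
  field_simp

theorem integral_isoGaussian {F : Type*} [NormedAddCommGroup F] [NormedSpace ℝ F]
    {γ : ℝ} (hγ : 0 < γ) (a : E) (f : E → F) :
    ∫ y, f y ∂isoGaussian γ a = ∫ u, isoDensity γ (u - a) • f u := by
  have hm : Measurable fun y : E => ENNReal.ofReal (isoDensity γ (y - a)) :=
    ((continuous_isoDensity γ).measurable.comp (measurable_id.sub_const a)).ennreal_ofReal
  rw [isoGaussian, integral_withDensity_eq_integral_toReal_smul hm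
    (Eventually.of_forall fun _ => ENNReal.ofReal_lt_top)]
  simp [ENNReal.toReal_ofReal (isoDensity_nonneg hγ _)]

theorem integral_isoGaussian_eq_integral_add {F : Type*} [NormedAddCommGroup F] [NormedSpace ℝ F]
    {γ : ℝ} (hγ : 0 < γ) (a : E) (f : E → F) :
    ∫ y, f y ∂isoGaussian γ a = ∫ u, isoDensity γ u • f (u + a) := by
  rw [integral_isoGaussian hγ, ← integral_add_right_eq_self _ a]
  simp

theorem charFun_isoGaussian {γ : ℝ} (hγ : 0 < γ) (a t : E) :
    charFun (isoGaussian γ a) t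
      = Complex.exp (inner ℝ a t * Complex.I - γ * ‖t‖ ^ 2) := by
  rw [charFun_apply, integral_isoGaussian_eq_integral_add hγ]
  have hb : 0 < (((4 * γ)⁻¹ : ℝ) : ℂ).re := by simp only [Complex.ofReal_re]; positivity
  have h := GaussianFourier.integral_cexp_neg_mul_sq_norm_add (V := E) hb Complex.I t
  have hc : 0 < 4 * Real.pi * γ := by positivity
  have h1 : (Real.pi / (((4 * γ)⁻¹ : ℝ) : ℂ)) ^ (Module.finrank ℝ E / 2 : ℂ)
      = (((4 * Real.pi * γ) ^ ((d : ℝ) / 2) : ℝ) : ℂ) := by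
    rw [Complex.ofReal_cpow hc.le]
    simp only [finrank_euclideanSpace, Fintype.card_fin]
    push_cast
    congr 1
    field_simp
  have h2 : ∀ u : E, isoDensity γ u • Complex.exp ((inner ℝ (u + a) t : ℝ) * Complex.I)
      = ((((4 * Real.pi * γ) ^ (-(d : ℝ) / 2) : ℝ) : ℂ) * Complex.exp (inner ℝ a t * Complex.I)) *
        Complex.exp (-(((4 * γ)⁻¹ : ℝ) : ℂ) * ‖u‖ ^ 2 + Complex.I * inner ℝ t u) := by
    intro u
    rw [isoDensity, Complex.real_smul, Complex.ofReal_mul, Complex.ofReal_exp, inner_add_left,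
      mul_assoc (Complex.ofReal _), ← Complex.exp_add, mul_assoc (Complex.ofReal _),
      ← Complex.exp_add, real_inner_comm u t]
    congr 2
    push_cast
    field_simp
    ring
  simp_rw [h2]
  rw [integral_const_mul, h, h1]
  have h3 : (4 * Real.pi * γ) ^ (-(d : ℝ) / 2) * (4 * Real.pi * γ) ^ ((d : ℝ) / 2) = 1 := by
    rw [← Real.rpow_add hc, neg_div, neg_add_cancel, Real.rpow_zero]
  rw [mul_mul_mul_comm, ← Complex.ofReal_mul, h3, Complex.ofReal_one, one_mul, ← Complex.exp_add]
  congr 1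
  have : (γ : ℂ) ≠ 0 := by exact_mod_cast hγ.ne'
  push_cast
  field_simp
  ring_nf
  rw [Complex.I_sq]
  ring

theorem isProbabilityMeasure_isoGaussian {γ : ℝ} (hγ : 0 < γ) (a : E) :
    IsProbabilityMeasure (isoGaussian γ a) := by
  have hint : Integrable (fun y => isoDensity γ (y - a)) :=
    (integrable_isoDensity hγ).comp_sub_right a
  have : IsFiniteMeasure (isoGaussian γ a) := isFiniteMeasure_withDensity_ofReal hint.2
  have h := charFun_isoGaussian hγ a 0
  simp only [charFun_zero, inner_zero_right, norm_zero] at h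
  refine ⟨?_⟩
  have h1 : (isoGaussian γ a).real univ = 1 := by
    have : (((isoGaussian γ a).real univ : ℝ) : ℂ) = 1 := by rw [h]; simp
    exact_mod_cast this
  rwa [measureReal_def, ENNReal.toReal_eq_one_iff] at h1

theorem isMarkovKernel_eulerKernel (U : E → ℝ) {γ : ℝ} (hγ : 0 < γ) :
    IsMarkovKernel (eulerKernel U γ) :=
  ⟨fun x => by rw [eulerKernel_apply]; exact isProbabilityMeasure_isoGaussian hγ _⟩

/-- The projection of `N(a, 2γ Id)` to the line spanned by a unit vector `e`. -/
theorem map_inner_isoGaussian {γ : ℝ≥0} (hγ : 0 < γ) (a : E) {e : E} (he : ‖e‖ = 1) :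
    (isoGaussian γ a).map (fun u => (inner ℝ u e : ℝ))
      = gaussianReal (inner ℝ a e) (2 * γ) := by
  have := isProbabilityMeasure_isoGaussian (γ := γ) hγ a
  have hm : Measurable fun u : E => (inner ℝ u e : ℝ) := by fun_prop
  have := Measure.isProbabilityMeasure_map (μ := isoGaussian γ a) hm.aemeasurable
  refine Measure.ext_of_charFun (funext fun s => ?_)
  rw [charFun_gaussianReal, charFun_apply_real, integral_map hm.aemeasurable
    (by fun_prop)]
  have h := charFun_isoGaussian (γ := γ) hγ a (s • e)
  rw [charFun_apply] at h
  simp only [inner_smul_right, norm_smul, he] at h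
  push_cast at h ⊢
  rw [h]
  congr 1
  rw [mul_one, ← Complex.ofReal_pow, Real.norm_eq_abs, sq_abs]
  push_cast
  ring

theorem lintegral_inner_sub_sq {γ : ℝ≥0} (hγ : 0 < γ) (a c : E) {e : E} (he : ‖e‖ = 1) :
    ∫⁻ u, ENNReal.ofReal ((inner ℝ u e - inner ℝ c e) ^ 2) ∂isoGaussian γ a
      = ENNReal.ofReal ((inner ℝ a e - inner ℝ c e) ^ 2 + 2 * γ) := by
  have hm : Measurable fun u : E => (inner ℝ u e : ℝ) := by fun_prop
  have h1 := lintegral_map (μ := isoGaussian γ a)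
    (f := fun t : ℝ => ENNReal.ofReal ((t - inner ℝ c e) ^ 2)) (by fun_prop) hm
  rw [map_inner_isoGaussian hγ a he] at h1
  rw [← h1]
  generalize inner ℝ a e = p
  generalize inner ℝ c e = q
  have hL : MemLp (fun t : ℝ => t) 2 (gaussianReal p (2 * γ)) := memLp_id_gaussianReal 2
  have hi2 : Integrable (fun t : ℝ => t ^ 2) (gaussianReal p (2 * γ)) := hL.integrable_sq
  have hi1 : Integrable (fun t : ℝ => t) (gaussianReal p (2 * γ)) := hL.integrable (by norm_num)
  have hint : Integrable (fun t : ℝ => (t - q) ^ 2) (gaussianReal p (2 * γ)) :=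
    (hL.sub (memLp_const q)).integrable_sq
  rw [← ofReal_integral_eq_lintegral_ofReal hint (Eventually.of_forall fun t => sq_nonneg _)]
  congr 1
  have hv := variance_eq_sub hL
  rw [variance_fun_id_gaussianReal] at hv
  simp only [Pi.pow_apply, integral_id_gaussianReal] at hv
  have : ∀ t : ℝ, (t - q) ^ 2 = (t ^ 2 - 2 * q * t) + q ^ 2 := fun t => by ring
  simp_rw [this]
  have hi3 : Integrable (fun t : ℝ => t ^ 2 - 2 * q * t) (gaussianReal p (2 * γ)) :=
    hi2.sub (hi1.const_mul _)
  rw [integral_add hi3 (integrable_const _), integral_sub hi2 (hi1.const_mul _),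
    integral_const_mul, integral_id_gaussianReal]
  push_cast at hv
  simp
  linarith

theorem lintegral_norm_sub_sq {γ : ℝ≥0} (hγ : 0 < γ) (a c : E) :
    ∫⁻ u, ENNReal.ofReal (‖u - c‖ ^ 2) ∂isoGaussian γ a
      = ENNReal.ofReal (‖a - c‖ ^ 2 + 2 * γ * d) := by
  let b := EuclideanSpace.basisFun (Fin d) ℝ
  have hsum : ∀ u : E, ‖u - c‖ ^ 2 = ∑ i, (inner ℝ u (b i) - inner ℝ c (b i)) ^ 2 := fun u => by
    rw [← b.sum_sq_inner_left]
    simp_rw [inner_sub_left]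
  simp_rw [hsum]
  simp_rw [ENNReal.ofReal_sum_of_nonneg (fun i _ => sq_nonneg _)]
  rw [lintegral_finsetSum _ (fun i _ => by fun_prop)]
  simp_rw [lintegral_inner_sub_sq hγ a c (b.orthonormal.1 _)]
  rw [← ENNReal.ofReal_sum_of_nonneg (fun i _ => by positivity), Finset.sum_add_distrib]
  congr 2
  simp
  ring

/-! ### The reflection estimate -/

/-- One Gaussian step improves a modulus of continuity of the form `gaussianSign w`. -/
theorem integral_isoGaussian_sub_le {γ w : ℝ≥0} (hγ : 0 < γ) {g : E → ℝ} (hg : Measurable g)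
    (hg1 : ∀ x, |g x| ≤ 1) (hmod : ∀ x y, |g x - g y| ≤ gaussianSign w ‖x - y‖) (a b : E) :
    |∫ u, g u ∂isoGaussian γ a - ∫ u, g u ∂isoGaussian γ b|
      ≤ gaussianSign (w + 8 * γ) ‖a - b‖ := by
  rcases eq_or_ne a b with rfl | hab
  · simp [gaussianSign_zero_right]
  have hr : 0 < ‖a - b‖ := norm_pos_iff.2 (sub_ne_zero.2 hab)
  -- Coordinates centred at the midpoint `c` of `a` and `b`, with `e` the direction of `a - b`;
  -- `τ` is the reflection that swaps `h = a - c` and `-h = b - c`.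
  set e : E := ‖a - b‖⁻¹ • (a - b) with he_def
  have he : ‖e‖ = 1 := norm_smul_inv_norm (𝕜 := ℝ) (sub_ne_zero.2 hab)
  set h : E := (2 : ℝ)⁻¹ • (a - b) with hh_def
  set c : E := (2 : ℝ)⁻¹ • (a + b) with hc_def
  have ha : c + h = a := by rw [hc_def, hh_def]; module
  have hb : c - h = b := by rw [hc_def, hh_def]; module
  have hhe : (inner ℝ h e : ℝ) = ‖a - b‖ / 2 := by
    rw [hh_def, he_def, inner_smul_left, inner_smul_right, real_inner_self_eq_norm_sq]
    simp
    field_simp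
  have hhe' : h = (‖a - b‖ / 2) • e := by
    rw [hh_def, he_def, smul_smul]
    congr 1
    field_simp
  let τ : E ≃ₗᵢ[ℝ] E := Submodule.reflection (Submodule.span ℝ {e})ᗮ
  have hτ : ∀ u, τ u = u - (2 * inner ℝ u e) • e := by
    intro u
    change Submodule.reflection (Submodule.span ℝ {e})ᗮ u = _
    rw [Submodule.reflection_orthogonal_apply, Submodule.reflection_singleton_apply, he,
      real_inner_comm]
    simp [mul_smul, two_smul]
  have hτh : τ h = -h := by
    rw [hτ, hhe, hhe']; module
  let q : E → ℝ := fun u => isoDensity γ (u - h) - isoDensity γ (u + h)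
  have hq1 : Integrable fun u : E => isoDensity (γ : ℝ) (u - h) :=
    (integrable_isoDensity hγ).comp_sub_right h
  have hq2 : Integrable fun u : E => isoDensity (γ : ℝ) (u + h) :=
    (integrable_isoDensity hγ).comp_add_right h
  have hqτ : ∀ u, q (τ u) = -q u := by
    intro u
    have h1 : isoDensity (γ : ℝ) (τ u - h) = isoDensity (γ : ℝ) (u + h) := by
      have : τ u - h = τ (u + h) := by rw [map_add, hτh, sub_eq_add_neg]
      simp only [isoDensity, this, LinearIsometryEquiv.norm_map]
    have h2 : isoDensity (γ : ℝ) (τ u + h) = isoDensity (γ : ℝ) (u - h) := by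
      have : τ u + h = τ (u - h) := by rw [map_sub, hτh, sub_neg_eq_add]
      simp only [isoDensity, this, LinearIsometryEquiv.norm_map]
    simp only [q, h1, h2]
    ring
  -- The difference of the densities has the sign of the coordinate along `e`.
  have hqsign : ∀ u, 0 ≤ inner ℝ u e → 0 ≤ q u := by
    intro u hu
    have hinn : 0 ≤ (inner ℝ u h : ℝ) := by
      rw [hhe', inner_smul_right]; positivity
    have hle : ‖u - h‖ ^ 2 ≤ ‖u + h‖ ^ 2 := by
      rw [norm_sub_sq_real, norm_add_sq_real]
      linarith
    have : isoDensity (γ : ℝ) (u + h) ≤ isoDensity (γ : ℝ) (u - h) := by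
      unfold isoDensity
      gcongr
    simpa [q] using this
  have hqsign' : ∀ u, inner ℝ u e ≤ 0 → q u ≤ 0 := by
    intro u hu
    have h1 : 0 ≤ inner ℝ (τ u) e := by
      rw [hτ, inner_sub_left, inner_smul_left, real_inner_self_eq_norm_sq, he]
      simp
      linarith
    have h2 := hqsign _ h1
    rw [hqτ] at h2
    linarith
  have key : ∀ f : E → ℝ, Measurable f → (∀ u, |f u| ≤ 1) →
      Integrable (fun u => q u * f u) ∧
      ∫ u, q u * f u = ∫ u, f u ∂isoGaussian γ h - ∫ u, f u ∂isoGaussian γ (-h) := by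
    intro f hf hf1
    have hbd : ∀ u, ‖f u‖ ≤ 1 := hf1
    have i1 := hq1.mul_bdd (c := 1) hf.aestronglyMeasurable (Eventually.of_forall hbd)
    have i2 := hq2.mul_bdd (c := 1) hf.aestronglyMeasurable (Eventually.of_forall hbd)
    have e1 := integral_isoGaussian (γ := γ) hγ h f
    have e2 := integral_isoGaussian (γ := γ) hγ (-h) f
    simp only [sub_neg_eq_add, smul_eq_mul] at e1 e2
    refine ⟨(i1.sub i2).congr (Eventually.of_forall fun u => (sub_mul _ _ _).symm), ?_⟩
    simp only [q, sub_mul]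
    rw [integral_sub i1 i2, e1, e2]
  -- Recentre the two integrals.
  have hL : ∫ u, g u ∂isoGaussian γ a - ∫ u, g u ∂isoGaussian γ b
      = ∫ u, q u * g (u + c) := by
    rw [(key (fun u => g (u + c)) (hg.comp (by fun_prop)) fun u => hg1 _).2]
    simp_rw [integral_isoGaussian_eq_integral_add (γ := γ) hγ]
    congr 2 <;> funext u <;> congr 2
    · rw [← ha]; abel
    · rw [← hb]; abel
  -- Antisymmetrize under the reflection.
  have iA := key (fun u => g (u + c)) (hg.comp (by fun_prop)) fun u => hg1 _
  have hrefl : ∫ u, q u * g (u + c) = -∫ u, q u * g (τ u + c) := by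
    rw [← τ.measurePreserving.integral_comp τ.toHomeomorph.measurableEmbedding, ← integral_neg]
    simp_rw [hqτ]
    congr 1
    funext u
    ring
  have hτm : Measurable τ := τ.continuous.measurable
  have iB := key (fun u => g (τ u + c)) (hg.comp (by fun_prop)) fun u => hg1 _
  have iC := key (fun u => gaussianSign w (2 * inner ℝ u e))
    ((monotone_gaussianSign w).measurable.comp (by fun_prop)) fun u => abs_gaussianSign_le_one _ _
  have hhalf : 2 * ∫ u, q u * g (u + c) = ∫ u, q u * (g (u + c) - g (τ u + c)) := by
    simp_rw [mul_sub]
    rw [integral_sub iA.1 iB.1]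
    linarith
  have hpt : ∀ u, |q u * (g (u + c) - g (τ u + c))| ≤ q u * gaussianSign w (2 * inner ℝ u e) := by
    intro u
    have h1 := hmod (u + c) (τ u + c)
    have h2 : ‖u + c - (τ u + c)‖ = |2 * inner ℝ u e| := by
      rw [hτ, add_sub_add_right_eq_sub, sub_sub_cancel, norm_smul, he, mul_one, Real.norm_eq_abs]
    rw [h2] at h1
    rw [abs_mul]
    rcases le_total 0 (inner ℝ u e : ℝ) with hu | hu
    · rw [abs_of_nonneg (hqsign u hu)]
      rw [abs_of_nonneg (show 0 ≤ 2 * (inner ℝ u e : ℝ) by linarith)] at h1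
      exact mul_le_mul_of_nonneg_left h1 (hqsign u hu)
    · rw [abs_of_nonpos (hqsign' u hu), neg_mul, ← mul_neg]
      rw [abs_of_nonpos (show 2 * (inner ℝ u e : ℝ) ≤ 0 by linarith), gaussianSign_neg] at h1
      have h3 := mul_le_mul_of_nonneg_left h1 (neg_nonneg.2 (hqsign' u hu))
      linarith
  have hC : ∀ p : E, ∫ u, gaussianSign w (2 * inner ℝ u e) ∂isoGaussian γ p
      = gaussianSign (w + 8 * γ) (2 * inner ℝ p e) := by
    intro p
    have hmap := map_inner_isoGaussian hγ p he
    have hmap2 := gaussianReal_map_const_mul (μ := inner ℝ p e) (v := 2 * γ) 2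
    have h8 : NNReal.mk ((2 : ℝ) ^ 2) (sq_nonneg _) * (2 * γ) = 8 * γ := by
      ext; change (2 : ℝ) ^ 2 * (2 * γ) = 8 * γ; ring
    rw [h8, ← hmap, Measure.map_map (by fun_prop) (by fun_prop)] at hmap2
    rw [← integral_gaussianSign, ← hmap2, integral_map (by fun_prop)
      (monotone_gaussianSign w).measurable.aestronglyMeasurable]
    rfl
  have hfin : |2 * ∫ u, q u * g (u + c)| ≤ 2 * gaussianSign (w + 8 * γ) ‖a - b‖ := by
    rw [hhalf]
    refine abs_integral_le_integral_abs.trans ?_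
    refine (integral_mono_of_nonneg (Eventually.of_forall fun u => abs_nonneg _) iC.1
      (Eventually.of_forall hpt)).trans ?_
    rw [iC.2, hC, hC, inner_neg_left, hhe, mul_neg, gaussianSign_neg,
      mul_div_cancel₀ _ (two_ne_zero' ℝ)]
    linarith
  rw [hL]
  rw [abs_mul, abs_two] at hfin
  linarith

end Gaussian

/-! ### Contraction of the gradient step -/

section Contraction

variable {d : ℕ} {U : EuclideanSpace ℝ (Fin d) → ℝ} {m L : ℝ}

local notation "E" => EuclideanSpace ℝ (Fin d)

/-- The quadratic upper bound for a function with Lipschitz gradient. -/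
theorem GradientLipschitz.le_add_inner (hL : GradientLipschitz U L) (x z : E) :
    U z ≤ U x + inner ℝ (gradient U x) (z - x) + L / 2 * ‖z - x‖ ^ 2 := by
  obtain ⟨hc, hL0, hlip⟩ := hL
  have hd : ∀ y, HasGradientAt U (gradient U y) y := fun y =>
    ((hc.differentiable one_ne_zero) y).hasGradientAt
  set v := z - x with hv
  -- Upper bound minus function along the segment from `x` to `z`, up to a constant; it is
  -- nondecreasing because the gradient is Lipschitz.
  let f : ℝ → ℝ := fun t =>
    t * inner ℝ (gradient U x) v + L / 2 * ‖v‖ ^ 2 * t ^ 2 - U (x + t • v)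
  have hf : ∀ t, HasDerivAt f
      (inner ℝ (gradient U x) v + L * ‖v‖ ^ 2 * t - inner ℝ (gradient U (x + t • v)) v) t := by
    intro t
    have h1 : HasDerivAt (fun t : ℝ => x + t • v) v t := by
      simpa using ((hasDerivAt_id t).smul_const v).const_add x
    have h2 := (hd (x + t • v)).hasFDerivAt.comp_hasDerivAt t h1
    have h3 := (((hasDerivAt_id t).mul_const (inner ℝ (gradient U x) v : ℝ)).add
      ((hasDerivAt_pow 2 t).const_mul (L / 2 * ‖v‖ ^ 2))).sub h2
    convert! h3 using 1
    simp
    ring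
  have hmono : MonotoneOn f (Icc 0 1) := by
    refine monotoneOn_of_deriv_nonneg (convex_Icc 0 1)
      (fun t _ => (hf t).continuousAt.continuousWithinAt)
      (fun t _ => (hf t).differentiableAt.differentiableWithinAt) fun t ht => ?_
    rw [interior_Icc] at ht
    rw [(hf t).deriv]
    have h1 := real_inner_le_norm (gradient U (x + t • v) - gradient U x) v
    have h2 := hlip (x + t • v) x
    rw [add_sub_cancel_left, norm_smul, Real.norm_eq_abs, abs_of_pos ht.1] at h2
    have h3 := mul_le_mul_of_nonneg_right h2 (norm_nonneg v)
    rw [inner_sub_left] at h1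
    nlinarith
  have h := hmono (left_mem_Icc.2 zero_le_one) (right_mem_Icc.2 zero_le_one) zero_le_one
  simp only [f, zero_mul, zero_smul, add_zero, one_smul, one_mul, one_pow, mul_one, hv,
    add_sub_cancel, zero_pow two_ne_zero, mul_zero, zero_sub] at h
  rw [hv]
  linarith

theorem inner_gradient_sub_ge (hm : StronglyConvex U m) (x y : E) :
    m * ‖x - y‖ ^ 2 ≤ inner ℝ (gradient U x - gradient U y) (x - y) := by
  have h1 := hm.2 x y
  have h2 := hm.2 y x
  rw [norm_sub_rev y x, ← neg_sub x y, inner_neg_right] at h1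
  rw [inner_sub_left]
  linarith

theorem le_of_gradientLipschitz_of_stronglyConvex (hd : 1 ≤ d) (hL : GradientLipschitz U L)
    (hm : StronglyConvex U m) : m ≤ L := by
  have : Nonempty (Fin d) := ⟨⟨0, hd⟩⟩
  obtain ⟨x, hx⟩ := exists_ne (0 : E)
  have hx' : 0 < ‖x‖ := norm_pos_iff.2 hx
  have h1 := inner_gradient_sub_ge hm x 0
  have h2 := real_inner_le_norm (gradient U x - gradient U 0) (x - 0)
  have h3 := mul_le_mul_of_nonneg_right (hL.2.2 x 0) (norm_nonneg (x - 0))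
  rw [sub_zero] at h1 h2 h3
  have h4 : m * ‖x‖ ^ 2 ≤ L * ‖x‖ ^ 2 := by nlinarith
  exact le_of_mul_le_mul_right h4 (by positivity)

/-- Strong convexity and co-coercivity of the gradient combined. Summing the quadratic bounds at
`y + a` and at `x - a` and choosing `a` optimally gives the inequality for every constant `L' > L`
(so that `L' > m` and the optimal `a` exists); then `L'` tends to `L`. -/
theorem mul_inner_gradient_sub_ge (hmL : m ≤ L) (hL : GradientLipschitz U L)
    (hm : StronglyConvex U m) (x y : E) :
    m * L * ‖x - y‖ ^ 2 + ‖gradient U x - gradient U y‖ ^ 2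
      ≤ (m + L) * inner ℝ (gradient U x - gradient U y) (x - y) := by
  set g := gradient U x - gradient U y with hg
  set δ := x - y with hδ
  have hgen : ∀ L', L < L' →
      m * L' * ‖δ‖ ^ 2 + ‖g‖ ^ 2 ≤ (m + L') * inner ℝ g δ := by
    intro L' hL'
    have hpos : 0 < L' - m := by linarith
    have hall : ∀ a : E, 2 * inner ℝ g a - inner ℝ g δ + m * ‖a - δ‖ ^ 2 - L' * ‖a‖ ^ 2 ≤ 0 := by
      intro a
      have h1 := hL.le_add_inner y (y + a)
      have h2 := hm.2 x (y + a)
      have h3 := hL.le_add_inner x (x - a)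
      have h4 := hm.2 y (x - a)
      rw [add_sub_cancel_left] at h1
      rw [show x - a - x = -a by abel, inner_neg_right, norm_neg] at h3
      rw [show y + a - x = a - δ by rw [hδ]; abel, inner_sub_right] at h2
      rw [show x - a - y = δ - a by rw [hδ]; abel, inner_sub_right, norm_sub_rev] at h4
      have h5 : (L' - L) * ‖a‖ ^ 2 ≥ 0 := mul_nonneg (by linarith) (by positivity)
      rw [hg, inner_sub_left, inner_sub_left]
      linarith
    have h := hall ((L' - m)⁻¹ • (g - m • δ))
    have e1 : ‖(L' - m)⁻¹ • (g - m • δ) - δ‖ ^ 2 = ((L' - m)⁻¹) ^ 2 * ‖g - m • δ‖ ^ 2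
        - 2 * (L' - m)⁻¹ * (inner ℝ g δ - m * ‖δ‖ ^ 2) + ‖δ‖ ^ 2 := by
      rw [norm_sub_sq_real, norm_smul, mul_pow, Real.norm_eq_abs, sq_abs, inner_smul_left,
        inner_sub_left, inner_smul_left, real_inner_self_eq_norm_sq]
      simp
      ring
    have e2 : ‖(L' - m)⁻¹ • (g - m • δ)‖ ^ 2 = ((L' - m)⁻¹) ^ 2 * ‖g - m • δ‖ ^ 2 := by
      rw [norm_smul, mul_pow, Real.norm_eq_abs, sq_abs]
    have e3 : ‖g - m • δ‖ ^ 2 = ‖g‖ ^ 2 - 2 * m * inner ℝ g δ + m ^ 2 * ‖δ‖ ^ 2 := by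
      rw [norm_sub_sq_real, norm_smul, mul_pow, Real.norm_eq_abs, sq_abs, inner_smul_right]
      ring
    rw [e1, e2, e3, inner_smul_right, inner_sub_right, inner_smul_right,
      real_inner_self_eq_norm_sq] at h
    generalize inner ℝ g δ = p at *
    generalize ‖g‖ ^ 2 = s at *
    generalize ‖δ‖ ^ 2 = t at *
    have h6 : (L' - m) * (2 * ((L' - m)⁻¹ * (s - m * p)) - p +
        m * ((L' - m)⁻¹ ^ 2 * (s - 2 * m * p + m ^ 2 * t) - 2 * (L' - m)⁻¹ * (p - m * t) + t) -
        L' * ((L' - m)⁻¹ ^ 2 * (s - 2 * m * p + m ^ 2 * t))) ≤ 0 :=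
      mul_nonpos_of_nonneg_of_nonpos hpos.le h
    have h7 : (L' - m) * (2 * ((L' - m)⁻¹ * (s - m * p)) - p +
        m * ((L' - m)⁻¹ ^ 2 * (s - 2 * m * p + m ^ 2 * t) - 2 * (L' - m)⁻¹ * (p - m * t) + t) -
        L' * ((L' - m)⁻¹ ^ 2 * (s - 2 * m * p + m ^ 2 * t)))
        = m * L' * t + s - (m + L') * p := by
      field_simp
      ring
    linarith
  have hlim : Tendsto (fun L' : ℝ => (m + L') * inner ℝ g δ - (m * L' * ‖δ‖ ^ 2 + ‖g‖ ^ 2))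
      (𝓝[>] L) (𝓝 ((m + L) * inner ℝ g δ - (m * L * ‖δ‖ ^ 2 + ‖g‖ ^ 2))) := by
    refine Tendsto.mono_left ?_ nhdsWithin_le_nhds
    exact Continuous.tendsto (by fun_prop) L
  have := ge_of_tendsto hlim (b := 0) (by
    filter_upwards [self_mem_nhdsWithin] with L' hL'
    have := hgen L' hL'
    linarith)
  linarith

theorem norm_gradient_step_sub_sq_le (hd : 1 ≤ d) (hL : GradientLipschitz U L)
    (hm : StronglyConvex U m) {γ : ℝ} (hγ : 0 < γ) (hγ' : γ ≤ 2 / (m + L)) (x y : E) :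
    ‖(x - γ • gradient U x) - (y - γ • gradient U y)‖ ^ 2
      ≤ (1 - kappa m L * γ) * ‖x - y‖ ^ 2 := by
  have hmL := le_of_gradientLipschitz_of_stronglyConvex hd hL hm
  have hs : 0 < m + L := by linarith [hm.1]
  have h := mul_inner_gradient_sub_ge hmL hL hm x y
  have e : (x - γ • gradient U x) - (y - γ • gradient U y)
      = (x - y) - γ • (gradient U x - gradient U y) := by module
  rw [e, norm_sub_sq_real, norm_smul, inner_smul_right, mul_pow, Real.norm_eq_abs, sq_abs,
    real_inner_comm, kappa]
  rw [le_div_iff₀ hs] at hγ'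
  generalize inner ℝ (gradient U x - gradient U y) (x - y) = p at *
  have hg : 0 ≤ ‖gradient U x - gradient U y‖ ^ 2 := sq_nonneg _
  generalize ‖gradient U x - gradient U y‖ ^ 2 = s at *
  generalize ‖x - y‖ ^ 2 = t at *
  have h1 : (m * L * t + s) / (m + L) ≤ p := by rw [div_le_iff₀ hs]; linarith
  have h2 : γ ^ 2 * s ≤ 2 * γ * (s / (m + L)) := by
    have : 2 * γ * (s / (m + L)) - γ ^ 2 * s = γ * s / (m + L) * (2 - γ * (m + L)) := by
      field_simp
    have h3 : 0 ≤ γ * s / (m + L) * (2 - γ * (m + L)) :=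
      mul_nonneg (by positivity) (by linarith)
    linarith
  have h4 : 2 * (γ * ((m * L * t + s) / (m + L))) ≤ 2 * (γ * p) := by gcongr
  have h5 : 2 * (γ * ((m * L * t + s) / (m + L)))
      = 2 * m * L / (m + L) * γ * t + 2 * γ * (s / (m + L)) := by
    field_simp
  linarith

theorem kappa_pos (hd : 1 ≤ d) (hL : GradientLipschitz U L) (hm : StronglyConvex U m) :
    0 < kappa m L := by
  have := le_of_gradientLipschitz_of_stronglyConvex hd hL hm
  have := hm.1
  have : 0 < L := by linarith
  unfold kappa
  positivity

theorem one_sub_kappa_mul_nonneg (hd : 1 ≤ d) (hL : GradientLipschitz U L)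
    (hm : StronglyConvex U m) {γ : ℝ} (hγ' : γ ≤ 2 / (m + L)) : 0 ≤ 1 - kappa m L * γ := by
  have hmL := le_of_gradientLipschitz_of_stronglyConvex hd hL hm
  have hs : 0 < m + L := by linarith [hm.1]
  have h1 : kappa m L * γ ≤ kappa m L * (2 / (m + L)) :=
    mul_le_mul_of_nonneg_left hγ' (kappa_pos hd hL hm).le
  have h2 : kappa m L * (2 / (m + L)) ≤ 1 := by
    unfold kappa
    rw [div_mul_div_comm, div_le_one (by positivity)]
    nlinarith [sq_nonneg (m - L)]
  linarith

theorem gradient_eq_zero_of_forall_le {z : E} (hz : ∀ y, U z ≤ U y) : gradient U z = 0 := by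
  have : IsLocalMin U z := Eventually.of_forall hz
  rw [gradient, this.fderiv_eq_zero, map_zero]

theorem existsUnique_minimizer (hL : GradientLipschitz U L) (hm : StronglyConvex U m) :
    ∃ xstar : E, (∀ y, U xstar ≤ U y) ∧ ∀ z, (∀ y, U z ≤ U y) → z = xstar := by
  have hc : Continuous U := hL.1.continuous
  have hm0 := hm.1
  -- `U` exceeds `U 0` outside the ball of radius `2 ‖∇U(0)‖ / m`.
  have hev : ∀ᶠ y in cocompact E, U 0 ≤ U y := by
    have hn : Tendsto (fun y : E => ‖y‖) (cocompact E) atTop := tendsto_norm_cocompact_atTop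
    have h := hn.eventually (eventually_ge_atTop
      (2 * ‖gradient U (0 : E)‖ / m))
    filter_upwards [h] with y hy
    have h1 := hm.2 0 y
    rw [sub_zero] at h1
    have h2 := neg_le_of_abs_le (abs_real_inner_le_norm (gradient U 0) y)
    rw [div_le_iff₀ hm0] at hy
    nlinarith [norm_nonneg y]
  obtain ⟨xs, hxs⟩ := hc.exists_forall_le' 0 hev
  refine ⟨xs, hxs, fun z hz => ?_⟩
  have h1 := hm.2 xs z
  rw [gradient_eq_zero_of_forall_le hxs, inner_zero_left, add_zero] at h1
  have h2 : m / 2 * ‖z - xs‖ ^ 2 ≤ 0 := by linarith [hz xs]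
  have h3 : ‖z - xs‖ ^ 2 = 0 :=
    le_antisymm (nonpos_of_mul_nonpos_right h2 (by positivity)) (sq_nonneg _)
  exact sub_eq_zero.1 (norm_eq_zero.1 (pow_eq_zero_iff two_ne_zero |>.1 h3))

end Contraction

/-! ### Smoothing by the Euler chain -/

section Chain

variable {d : ℕ} {U : EuclideanSpace ℝ (Fin d) → ℝ} {m L : ℝ}

local notation "E" => EuclideanSpace ℝ (Fin d)

theorem measurable_integral_eulerKernel (U : E → ℝ) {γ : ℝ} (hγ : 0 < γ) {g : E → ℝ}
    (hg : Measurable g) : Measurable fun x => ∫ y, g y ∂eulerKernel U γ x := by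
  have := isMarkovKernel_eulerKernel U hγ
  exact (hg.stronglyMeasurable.integral_kernel (κ := eulerKernel U γ)).measurable

/-- One Euler step: the contraction of the drift and the Gaussian noise both improve the modulus
of continuity. -/
theorem integral_eulerKernel_sub_le (hd : 1 ≤ d) (hL : GradientLipschitz U L)
    (hm : StronglyConvex U m) {γ : ℝ} (hγ : 0 < γ) (hγ' : γ ≤ 2 / (m + L))
    (hq : 0 < 1 - kappa m L * γ) {v : ℝ} (hv : 0 ≤ v) {g : E → ℝ} (hg : Measurable g)
    (hg1 : ∀ x, |g x| ≤ 1) (hmod : ∀ x y, |g x - g y| ≤ gaussianSign v.toNNReal ‖x - y‖)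
    (x y : E) :
    |∫ u, g u ∂eulerKernel U γ x - ∫ u, g u ∂eulerKernel U γ y|
      ≤ gaussianSign ((v + 8 * γ) * (1 - kappa m L * γ)⁻¹).toNNReal ‖x - y‖ := by
  have hc := norm_gradient_step_sub_sq_le hd hL hm hγ hγ' x y
  rw [eulerKernel_apply, eulerKernel_apply]
  generalize 1 - kappa m L * γ = q at *
  have h1 := integral_isoGaussian_sub_le (γ := γ.toNNReal) (by simpa using hγ) hg hg1 hmod
    (x - γ • gradient U x) (y - γ • gradient U y)
  rw [Real.coe_toNNReal γ hγ.le] at h1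
  refine h1.trans ?_
  have h2 : ‖(x - γ • gradient U x) - (y - γ • gradient U y)‖ ≤ √q * ‖x - y‖ := by
    refine abs_le_of_sq_le_sq' ?_ (by positivity) |>.2
    rwa [mul_pow, Real.sq_sqrt hq.le]
  refine (monotone_gaussianSign _ h2).trans (le_of_eq ?_)
  have h3 := gaussianSign_scale ((v + 8 * γ) * q⁻¹).toNNReal ‖x - y‖
    (c := NNReal.sqrt q.toNNReal) (by simpa using hq)
  rw [NNReal.sq_sqrt, Real.coe_sqrt, Real.coe_toNNReal q hq.le, ← Real.toNNReal_mul hq.le,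
    mul_comm q, inv_mul_cancel_right₀ hq.ne', Real.toNNReal_add hv (by positivity),
    Real.toNNReal_mul (by norm_num : (0 : ℝ) ≤ 8)] at h3
  simpa using h3

theorem eulerKernel_eq_of_eq_zero (hd : 1 ≤ d) (hL : GradientLipschitz U L)
    (hm : StronglyConvex U m) {γ : ℝ} (hγ : 0 < γ) (hγ' : γ ≤ 2 / (m + L))
    (hq : 1 - kappa m L * γ = 0) (x y : E) : eulerKernel U γ x = eulerKernel U γ y := by
  have hc := norm_gradient_step_sub_sq_le hd hL hm hγ hγ' x y
  rw [hq, zero_mul] at hc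
  have h : ‖(x - γ • gradient U x) - (y - γ • gradient U y)‖ = 0 :=
    pow_eq_zero_iff two_ne_zero |>.1 (le_antisymm hc (sq_nonneg _))
  rw [eulerKernel_apply, eulerKernel_apply, sub_eq_zero.1 (norm_eq_zero.1 h)]

theorem eulerChain_succ_of_le (U : E → ℝ) (γ : ℕ → ℝ) {n ℓ : ℕ} (h : n ≤ ℓ + 1) :
    eulerChain U γ n (ℓ + 1) = eulerKernel U (γ (ℓ + 1)) ∘ₖ eulerChain U γ n ℓ := by
  rw [eulerChain, if_pos h]

theorem eulerChain_of_lt (U : E → ℝ) (γ : ℕ → ℝ) {n ℓ : ℕ} (h : ℓ < n) :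
    eulerChain U γ n ℓ = Kernel.id := by
  cases ℓ with
  | zero => rfl
  | succ ℓ => rw [eulerChain, if_neg (by omega)]

theorem isMarkovKernel_eulerChain (U : E → ℝ) {γ : ℕ → ℝ} (hγ : ∀ k, 1 ≤ k → 0 < γ k) (n ℓ : ℕ) :
    IsMarkovKernel (eulerChain U γ n ℓ) := by
  induction ℓ with
  | zero => rw [eulerChain]; infer_instance
  | succ ℓ ih =>
    rw [eulerChain]
    have := isMarkovKernel_eulerKernel U (hγ (ℓ + 1) (by omega))
    split_ifs <;> infer_instance

theorem integral_eulerChain_succ (U : E → ℝ) {γ : ℕ → ℝ} (hγ : ∀ k, 1 ≤ k → 0 < γ k) {n ℓ : ℕ}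
    (h : n ≤ ℓ + 1) {g : E → ℝ} (hg : Measurable g) (hg1 : ∀ x, |g x| ≤ 1) (x : E) :
    ∫ z, g z ∂eulerChain U γ n (ℓ + 1) x
      = ∫ y, ∫ z, g z ∂eulerKernel U (γ (ℓ + 1)) y ∂eulerChain U γ n ℓ x := by
  have := isMarkovKernel_eulerChain U hγ n ℓ
  have := isMarkovKernel_eulerKernel U (hγ (ℓ + 1) (by omega))
  rw [eulerChain_succ_of_le U γ h, Kernel.integral_comp (integrable_of_abs_le hg hg1)]

theorem abs_integral_le_one {α : Type*} [MeasurableSpace α] {μ : Measure α}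
    [IsProbabilityMeasure μ] {f : α → ℝ} (hf : ∀ x, |f x| ≤ 1) : |∫ x, f x ∂μ| ≤ 1 := by
  have := norm_integral_le_of_norm_le_const (μ := μ)
    (Eventually.of_forall fun z => (Real.norm_eq_abs (f z)).trans_le (hf z))
  simpa using this

theorem StepSizes.le {γ : ℕ → ℝ} {c : ℝ} (h : StepSizes γ c) {k : ℕ} (hk : 1 ≤ k) : γ k ≤ c := by
  induction k, hk using Nat.le_induction with
  | base => exact h.2.2
  | succ k hk ih => exact (h.2.1 k hk).trans ih

theorem Lam_of_lt (κ : ℝ) (γ : ℕ → ℝ) {n ℓ : ℕ} (h : ℓ < n) : Lam κ γ n ℓ = 0 := by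
  simp [Lam, Finset.Icc_eq_empty_of_lt h]

theorem Lam_succ {κ : ℝ} (hκ : κ ≠ 0) (γ : ℕ → ℝ) {n ℓ : ℕ} (h : n ≤ ℓ + 1)
    (hq : 1 - κ * γ (ℓ + 1) ≠ 0) :
    Lam κ γ n (ℓ + 1)
      = Lam κ γ n ℓ + γ (ℓ + 1) * ∏ j ∈ Finset.Icc n (ℓ + 1), (1 - κ * γ j)⁻¹ := by
  rw [Lam, Lam, Finset.prod_Icc_succ_top h]
  field_simp
  ring

theorem Lam_nonneg {κ : ℝ} (hκ : 0 < κ) {γ : ℕ → ℝ} (hγ : ∀ k, 1 ≤ k → 0 < γ k) {n : ℕ}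
    (hn : 1 ≤ n) (ℓ : ℕ) (hq : ∀ j ∈ Finset.Icc n ℓ, 0 < 1 - κ * γ j) : 0 ≤ Lam κ γ n ℓ := by
  have h1 : ∏ j ∈ Finset.Icc n ℓ, (1 - κ * γ j) ≤ 1 :=
    Finset.prod_le_one (fun j hj => (hq j hj).le) fun j hj => by
      linarith [mul_pos hκ (hγ j (hn.trans (Finset.mem_Icc.1 hj).1))]
  rw [Lam, Finset.prod_inv_distrib]
  exact mul_nonneg (by positivity)
    (sub_nonneg.2 ((one_le_inv₀ (Finset.prod_pos hq)).2 h1))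

theorem Lam_pos {κ : ℝ} (hκ : 0 < κ) {γ : ℕ → ℝ} (hγ : ∀ k, 1 ≤ k → 0 < γ k) {n ℓ : ℕ}
    (hn : 1 ≤ n) (hnl : n ≤ ℓ) (hq : ∀ j ∈ Finset.Icc n ℓ, 0 < 1 - κ * γ j) :
    0 < Lam κ γ n ℓ := by
  obtain ⟨k, rfl⟩ : ∃ k, ℓ = k + 1 := ⟨ℓ - 1, by omega⟩
  rw [Lam_succ hκ.ne' γ hnl (hq _ (Finset.mem_Icc.2 ⟨hnl, le_rfl⟩)).ne']
  refine add_pos_of_nonneg_of_pos (Lam_nonneg hκ hγ hn k fun j hj => hq j ?_)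
    (mul_pos (hγ _ (by omega)) (Finset.prod_pos fun j hj => inv_pos.2 (hq j hj)))
  rw [Finset.mem_Icc] at hj ⊢
  omega

theorem integral_eulerChain_sub_le_of_lt {γ : ℕ → ℝ} {n ℓ : ℕ} (h : ℓ < n) (κ : ℝ) {v : ℝ}
    {g : E → ℝ} (hmod : ∀ x y, |g x - g y| ≤ gaussianSign v.toNNReal ‖x - y‖) (x y : E) :
    |∫ u, g u ∂eulerChain U γ n ℓ x - ∫ u, g u ∂eulerChain U γ n ℓ y|
      ≤ gaussianSign (v * ∏ j ∈ Finset.Icc n ℓ, (1 - κ * γ j)⁻¹ + 8 * Lam κ γ n ℓ).toNNReal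
          ‖x - y‖ := by
  rw [eulerChain_of_lt U γ h, Lam_of_lt _ γ h, Finset.Icc_eq_empty_of_lt h]
  simpa [Kernel.id_apply] using hmod x y

/-- The modulus of continuity of the chain, by induction on its last step, for an arbitrary initial
modulus. -/
theorem integral_eulerChain_sub_le (hd : 1 ≤ d) (hL : GradientLipschitz U L)
    (hm : StronglyConvex U m) {γ : ℕ → ℝ} (hγ : StepSizes γ (2 / (m + L))) {n : ℕ} (hn : 1 ≤ n)
    (ℓ : ℕ) (hq : ∀ j ∈ Finset.Icc n ℓ, 0 < 1 - kappa m L * γ j) {v : ℝ} (hv : 0 ≤ v)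
    {g : E → ℝ} (hg : Measurable g) (hg1 : ∀ x, |g x| ≤ 1)
    (hmod : ∀ x y, |g x - g y| ≤ gaussianSign v.toNNReal ‖x - y‖) (x y : E) :
    |∫ u, g u ∂eulerChain U γ n ℓ x - ∫ u, g u ∂eulerChain U γ n ℓ y|
      ≤ gaussianSign (v * ∏ j ∈ Finset.Icc n ℓ, (1 - kappa m L * γ j)⁻¹
          + 8 * Lam (kappa m L) γ n ℓ).toNNReal ‖x - y‖ := by
  induction ℓ generalizing v g with
  | zero => exact integral_eulerChain_sub_le_of_lt hn _ hmod x y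
  | succ ℓ ih =>
    rcases lt_or_ge (ℓ + 1) n with h | h
    · exact integral_eulerChain_sub_le_of_lt h _ hmod x y
    have hql := hq (ℓ + 1) (Finset.mem_Icc.2 ⟨h, le_rfl⟩)
    have hγl := hγ.1 (ℓ + 1) (by omega)
    have hγl' := hγ.le (k := ℓ + 1) (by omega)
    have hM := isMarkovKernel_eulerKernel U hγl
    rw [integral_eulerChain_succ U hγ.1 h hg hg1, integral_eulerChain_succ U hγ.1 h hg hg1]
    have hstep := integral_eulerKernel_sub_le hd hL hm hγl hγl' hql hv hg hg1 hmod
    have hv' : 0 ≤ (v + 8 * γ (ℓ + 1)) * (1 - kappa m L * γ (ℓ + 1))⁻¹ := by positivity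
    have hmeas := measurable_integral_eulerKernel U hγl hg
    have hbd : ∀ x, |∫ u, g u ∂eulerKernel U (γ (ℓ + 1)) x| ≤ 1 := fun x => abs_integral_le_one hg1
    refine (ih (fun j hj => hq j ?_) hv' hmeas hbd hstep).trans (le_of_eq ?_)
    · rw [Finset.mem_Icc] at hj ⊢
      omega
    · congr 2
      rw [Lam_succ (kappa_pos hd hL hm).ne' γ h hql.ne', Finset.prod_Icc_succ_top h]
      ring

theorem integral_eulerChain_eq_of_eq_zero (hd : 1 ≤ d) (hL : GradientLipschitz U L)
    (hm : StronglyConvex U m) {γ : ℕ → ℝ} (hγ : StepSizes γ (2 / (m + L))) {n : ℕ} (hn : 1 ≤ n)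
    (ℓ : ℕ) {j : ℕ} (hj : j ∈ Finset.Icc n ℓ) (hq : 1 - kappa m L * γ j = 0)
    {g : E → ℝ} (hg : Measurable g) (hg1 : ∀ x, |g x| ≤ 1) (x y : E) :
    ∫ u, g u ∂eulerChain U γ n ℓ x = ∫ u, g u ∂eulerChain U γ n ℓ y := by
  rw [Finset.mem_Icc] at hj
  induction ℓ generalizing g with
  | zero => omega
  | succ ℓ ih =>
    have hγl := hγ.1 (ℓ + 1) (by omega)
    have hM := isMarkovKernel_eulerKernel U hγl
    rw [integral_eulerChain_succ U hγ.1 (by omega) hg hg1,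
      integral_eulerChain_succ U hγ.1 (by omega) hg hg1]
    rcases eq_or_ne j (ℓ + 1) with rfl | hne
    · have hM' := isMarkovKernel_eulerChain U hγ.1 n ℓ
      simp_rw [fun z => eulerKernel_eq_of_eq_zero hd hL hm hγl (hγ.le (by omega)) hq z 0]
      simp
    · exact ih (by omega) (measurable_integral_eulerKernel U hγl hg)
        fun x => abs_integral_le_one hg1

/-- The chain started at two points. If some factor `1 - κ γ_j` vanishes, the two laws agree and
`Lam` is negative, so that the bound is `0`. -/
theorem eulerChain_real_sub_le (hd : 1 ≤ d) (hL : GradientLipschitz U L)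
    (hm : StronglyConvex U m) {γ : ℕ → ℝ} (hγ : StepSizes γ (2 / (m + L))) {n ℓ : ℕ} (hn : 1 ≤ n)
    (hnl : n ≤ ℓ) {A : Set E} (hA : MeasurableSet A) (x y : E) :
    |(eulerChain U γ n ℓ x).real A - (eulerChain U γ n ℓ y).real A|
        ≤ 1 - 2 * Phi (-(‖x - y‖ / √(8 * Lam (kappa m L) γ n ℓ))) ∧
      |(eulerChain U γ n ℓ x).real A - (eulerChain U γ n ℓ y).real A|
        ≤ (√(4 * Real.pi * Lam (kappa m L) γ n ℓ))⁻¹ * ‖x - y‖ := by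
  have hκ := kappa_pos hd hL hm
  have hg : Measurable (A.indicator fun _ : E => (1 : ℝ)) := measurable_const.indicator hA
  have hg1 : ∀ x, |A.indicator (fun _ : E => (1 : ℝ)) x| ≤ 1 := fun x => by
    by_cases hx : x ∈ A <;> simp [hx]
  have hint : ∀ z, ∫ u, A.indicator (fun _ : E => (1 : ℝ)) u ∂eulerChain U γ n ℓ z
      = (eulerChain U γ n ℓ z).real A := fun z => by
    rw [integral_indicator_const _ hA, smul_eq_mul, mul_one]
  by_cases hq : ∀ j ∈ Finset.Icc n ℓ, 0 < 1 - kappa m L * γ j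
  · have hΛ := Lam_pos hκ hγ.1 hn hnl hq
    have hmod : ∀ x y, |A.indicator (fun _ : E => (1 : ℝ)) x - A.indicator (fun _ => (1 : ℝ)) y|
        ≤ gaussianSign (0 : ℝ).toNNReal ‖x - y‖ := by
      intro x y
      rw [Real.toNNReal_zero, gaussianSign_zero_left]
      rcases eq_or_ne x y with rfl | hxy
      · simp
      · rw [Real.sign_of_pos (norm_pos_iff.2 (sub_ne_zero.2 hxy))]
        by_cases hx : x ∈ A <;> by_cases hy : y ∈ A <;> simp [hx, hy]
    have h := integral_eulerChain_sub_le hd hL hm hγ hn ℓ hq le_rfl hg hg1 hmod x y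
    rw [hint, hint, zero_mul, zero_add] at h
    have h8 : 0 < (8 * Lam (kappa m L) γ n ℓ).toNNReal := by simpa using hΛ
    refine ⟨h.trans (le_of_eq ?_), h.trans ((gaussianSign_le _ h8 (norm_nonneg _)).trans
      (le_of_eq ?_))⟩
    · rw [gaussianSign_eq_one_sub _ h8, Real.coe_toNNReal _ (by positivity)]
    · rw [Real.coe_toNNReal _ (by positivity),
        show 2 * Real.pi * (8 * Lam (kappa m L) γ n ℓ)
          = 2 ^ 2 * (4 * Real.pi * Lam (kappa m L) γ n ℓ) by ring,
        Real.sqrt_mul (by positivity), Real.sqrt_sq (by norm_num)]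
      field_simp
  · push Not at hq
    obtain ⟨j, hj, hj0⟩ := hq
    have hj1 := hn.trans (Finset.mem_Icc.1 hj).1
    have hz := le_antisymm hj0 (one_sub_kappa_mul_nonneg hd hL hm (hγ.le hj1))
    have h := integral_eulerChain_eq_of_eq_zero hd hL hm hγ hn ℓ hj hz hg hg1 x y
    rw [hint, hint] at h
    have hΛ : Lam (kappa m L) γ n ℓ ≤ 0 := by
      rw [Lam, Finset.prod_eq_zero hj (by rw [hz, inv_zero])]
      simp [hκ.le]
    have h8 : √(8 * Lam (kappa m L) γ n ℓ) = 0 := Real.sqrt_eq_zero_of_nonpos (by linarith)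
    have hhalf := gaussianSign_eq_one_sub 1 one_pos 0
    rw [gaussianSign_zero_right, zero_div] at hhalf
    rw [h, sub_self, abs_zero, h8, div_zero]
    exact ⟨hhalf.le, by positivity⟩

end Chain

/-! ### Total variation and couplings -/

section Coupling

theorem tvDist_le {α : Type*} [MeasurableSpace α] {μ ν : Measure α} {c : ℝ}
    (h : ∀ A, MeasurableSet A → |μ.real A - ν.real A| ≤ c) : tvDist μ ν ≤ c :=
  have : Nonempty {A : Set α // MeasurableSet A} := ⟨⟨∅, MeasurableSet.empty⟩⟩
  ciSup_le fun A => h A.1 A.2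

theorem measurable_kernel_real {α β : Type*} [MeasurableSpace α] [MeasurableSpace β]
    (κ : Kernel α β) {A : Set β} (hA : MeasurableSet A) : Measurable fun x => (κ x).real A :=
  (κ.measurable_coe hA).ennreal_toReal

theorem comp_real_eq_integral {α β : Type*} [MeasurableSpace α] [MeasurableSpace β]
    (κ : Kernel α β) [IsMarkovKernel κ] (μ : Measure α) {A : Set β} (hA : MeasurableSet A) :
    (κ ∘ₘ μ).real A = ∫ x, (κ x).real A ∂μ := by
  simp_rw [measureReal_def]
  rw [Measure.bind_apply hA κ.aemeasurable,
    integral_toReal (κ.measurable_coe hA).aemeasurable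
      (Eventually.of_forall fun x => measure_lt_top _ _)]

variable {d : ℕ}

local notation "E" => EuclideanSpace ℝ (Fin d)

/-- A Lipschitz bound on `x ↦ κ x A` controls `κ ∘ₘ μ` and `κ ∘ₘ ν` by the cost of a coupling of
`μ` and `ν`. -/
theorem ofReal_abs_comp_real_sub_le {κ : Kernel E E} [IsMarkovKernel κ] {C : ℝ} (hC : 0 ≤ C)
    {A : Set E} (hA : MeasurableSet A) (h : ∀ x y, |(κ x).real A - (κ y).real A| ≤ C * ‖x - y‖)
    {μ ν : Measure E} [IsProbabilityMeasure μ] {ζ : Measure (E × E)}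
    (h1 : ζ.map Prod.fst = μ) (h2 : ζ.map Prod.snd = ν) :
    ENNReal.ofReal |(κ ∘ₘ μ).real A - (κ ∘ₘ ν).real A|
      ≤ ENNReal.ofReal C * ∫⁻ p, ENNReal.ofReal ‖p.1 - p.2‖ ∂ζ := by
  have hζ : IsProbabilityMeasure ζ :=
    ⟨by rw [← preimage_univ (f := Prod.fst), ← Measure.map_apply measurable_fst .univ, h1,
      measure_univ]⟩
  have hm := measurable_kernel_real κ hA
  have hb : ∀ x, |(κ x).real A| ≤ 1 := fun x => by
    rw [abs_of_nonneg measureReal_nonneg]; exact measureReal_le_one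
  have e : (κ ∘ₘ μ).real A - (κ ∘ₘ ν).real A
      = ∫ p, ((κ p.1).real A - (κ p.2).real A) ∂ζ := by
    rw [comp_real_eq_integral κ μ hA, comp_real_eq_integral κ ν hA, ← h1, ← h2,
      integral_map (by fun_prop) hm.aestronglyMeasurable,
      integral_map (by fun_prop) hm.aestronglyMeasurable, integral_sub]
    · exact integrable_of_abs_le (hm.comp measurable_fst) fun p => hb _
    · exact integrable_of_abs_le (hm.comp measurable_snd) fun p => hb _
  rw [e, ← Real.norm_eq_abs, ofReal_norm,
    ← lintegral_const_mul' _ _ ENNReal.ofReal_ne_top]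
  refine (enorm_integral_le_lintegral_enorm _).trans (lintegral_mono fun p => ?_)
  rw [← ofReal_norm, Real.norm_eq_abs, ← ENNReal.ofReal_mul hC]
  exact ENNReal.ofReal_le_ofReal (h _ _)

theorem tvDist_comp_le_W1 {κ : Kernel E E} [IsMarkovKernel κ] {C : ℝ} (hC : 0 ≤ C)
    (h : ∀ A, MeasurableSet A → ∀ x y, |(κ x).real A - (κ y).real A| ≤ C * ‖x - y‖)
    {μ ν : Measure E} (hμ : InP1 μ) (hν : InP1 ν) :
    tvDist (κ ∘ₘ μ) (κ ∘ₘ ν) ≤ C * W1 μ ν := by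
  have := hμ.1
  have := hν.1
  refine tvDist_le fun A hA => ?_
  have hp1 : (μ.prod ν).map Prod.fst = μ := Measure.fst_prod
  have hp2 : (μ.prod ν).map Prod.snd = ν := Measure.snd_prod
  -- The product coupling shows that the infimum over all couplings is finite.
  have hfin : (⨅ ζ ∈ {ζ : Measure (E × E) | ζ.map Prod.fst = μ ∧ ζ.map Prod.snd = ν},
      ∫⁻ p, ENNReal.ofReal ‖p.1 - p.2‖ ∂ζ) ≠ ∞ := by
    refine ne_top_of_le_ne_top ?_ (iInf₂_le (μ.prod ν) ⟨hp1, hp2⟩)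
    have hi : Integrable (fun p : E × E => ‖p.1‖ + ‖p.2‖) (μ.prod ν) :=
      (hμ.2.comp_fst ν).add (hν.2.comp_snd μ)
    refine ne_top_of_le_ne_top hi.2.ne (lintegral_mono fun p => ?_)
    rw [← ofReal_norm, Real.norm_eq_abs, abs_of_nonneg (by positivity)]
    exact ENNReal.ofReal_le_ofReal (norm_sub_le _ _)
  have hle : ENNReal.ofReal |(κ ∘ₘ μ).real A - (κ ∘ₘ ν).real A| ≤ ENNReal.ofReal C *
      ⨅ ζ ∈ {ζ : Measure (E × E) | ζ.map Prod.fst = μ ∧ ζ.map Prod.snd = ν},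
        ∫⁻ p, ENNReal.ofReal ‖p.1 - p.2‖ ∂ζ := by
    rcases hC.eq_or_lt with rfl | hC'
    · simpa using ofReal_abs_comp_real_sub_le le_rfl hA (h A hA) hp1 hp2
    · have hC0 : ENNReal.ofReal C ≠ 0 := by simpa using hC'
      rw [mul_comm, ← ENNReal.div_le_iff_le_mul (Or.inl hC0) (Or.inl ENNReal.ofReal_ne_top)]
      refine le_iInf₂ fun ζ hζ => ?_
      rw [ENNReal.div_le_iff_le_mul (Or.inl hC0) (Or.inl ENNReal.ofReal_ne_top), mul_comm]
      exact ofReal_abs_comp_real_sub_le hC hA (h A hA) hζ.1 hζ.2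
  rw [W1, ← ENNReal.toReal_ofReal hC, ← ENNReal.toReal_mul]
  exact (ENNReal.ofReal_le_iff_le_toReal (ENNReal.mul_ne_top ENNReal.ofReal_ne_top hfin)).1 hle

theorem lintegral_norm_sub_le_sqrt {μ : Measure E} [IsProbabilityMeasure μ] {c : E} {S : ℝ}
    (hS : 0 < S) (h : ∫⁻ y, ENNReal.ofReal (‖y - c‖ ^ 2) ∂μ ≤ ENNReal.ofReal S) :
    ∫⁻ y, ENNReal.ofReal ‖y - c‖ ∂μ ≤ ENNReal.ofReal √S := by
  have hs : 0 < √S := Real.sqrt_pos.2 hS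
  have hpt : ∀ y, ENNReal.ofReal ‖y - c‖
      ≤ ENNReal.ofReal (2 * √S)⁻¹ * ENNReal.ofReal (‖y - c‖ ^ 2) + ENNReal.ofReal (√S / 2) := by
    intro y
    rw [← ENNReal.ofReal_mul (by positivity), ← ENNReal.ofReal_add (by positivity) (by positivity)]
    refine ENNReal.ofReal_le_ofReal ?_
    have : (2 * √S)⁻¹ * ‖y - c‖ ^ 2 + √S / 2 - ‖y - c‖ = (2 * √S)⁻¹ * (‖y - c‖ - √S) ^ 2 := by
      field_simp
      ring
    have h2 : 0 ≤ (2 * √S)⁻¹ * (‖y - c‖ - √S) ^ 2 := by positivity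
    linarith
  refine (lintegral_mono hpt).trans ?_
  rw [lintegral_add_right _ measurable_const, lintegral_const_mul' _ _ ENNReal.ofReal_ne_top,
    lintegral_const, measure_univ, mul_one]
  refine (add_le_add_left (mul_le_mul_right h _) _).trans ?_
  rw [← ENNReal.ofReal_mul (by positivity), ← ENNReal.ofReal_add (by positivity) (by positivity)]
  refine ENNReal.ofReal_le_ofReal (le_of_eq ?_)
  have : S = √S ^ 2 := (Real.sq_sqrt hS.le).symm
  nth_rw 2 [this]
  field_simp
  ring

end Coupling

/-! ### Setwise limits of probability measures -/

section Setwise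

variable {α : Type*} [MeasurableSpace α]

/-- Probability measures are complete for the total variation distance. -/
theorem exists_setwise_limit (ν : ℕ → Measure α) [∀ n, IsProbabilityMeasure (ν n)] {ε : ℕ → ℝ}
    (hε : Tendsto ε atTop (𝓝 0))
    (h : ∀ n k, n ≤ k → ∀ A, MeasurableSet A → |(ν n).real A - (ν k).real A| ≤ ε n) :
    ∃ π : Measure α, IsProbabilityMeasure π ∧
      ∀ A, MeasurableSet A → Tendsto (fun n => (ν n).real A) atTop (𝓝 (π.real A)) := by
  have hex : ∀ A, ∃ a, MeasurableSet A → Tendsto (fun n => (ν n).real A) atTop (𝓝 a) := by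
    intro A
    by_cases hA : MeasurableSet A
    · have hC : CauchySeq fun n => (ν n).real A :=
        cauchySeq_of_le_tendsto_0' ε (fun n k hnk => h n k hnk A hA) hε
      obtain ⟨a, ha⟩ := cauchySeq_tendsto_of_complete hC
      exact ⟨a, fun _ => ha⟩
    · exact ⟨0, fun h => absurd h hA⟩
  choose a ha using hex
  have ha0 : ∀ A, MeasurableSet A → 0 ≤ a A := fun A hA =>
    ge_of_tendsto' (ha A hA) fun n => measureReal_nonneg
  -- Countable additivity: the partial sums converge uniformly in `n`.
  have hsum : ∀ f : ℕ → Set α, (∀ i, MeasurableSet (f i)) → Pairwise (Function.onFun Disjoint f) →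
      HasSum (fun i => a (f i)) (a (⋃ i, f i)) := by
    intro f hf hd
    rw [hasSum_iff_tendsto_nat_of_nonneg fun i => ha0 _ (hf i)]
    have hpart : ∀ n N, ∑ i ∈ Finset.range N, (ν n).real (f i)
        = (ν n).real (⋃ i ∈ Finset.range N, f i) := fun n N =>
      (measureReal_biUnion_finset (fun i _ j _ hij => hd hij) fun i _ => hf i).symm
    have hlim : ∀ N, Tendsto (fun k => ∑ i ∈ Finset.range N, (ν k).real (f i)) atTop
        (𝓝 (∑ i ∈ Finset.range N, a (f i))) := fun N =>
      tendsto_finsetSum _ fun i _ => ha _ (hf i)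
    have hunif : TendstoUniformly (fun n N => ∑ i ∈ Finset.range N, (ν n).real (f i))
        (fun N => ∑ i ∈ Finset.range N, a (f i)) atTop := by
      rw [Metric.tendstoUniformly_iff]
      intro η hη
      filter_upwards [hε.eventually (gt_mem_nhds hη)] with n hn N
      refine lt_of_le_of_lt ?_ hn
      rw [dist_comm, Real.dist_eq]
      refine le_of_tendsto ((tendsto_const_nhds.sub (hlim N)).abs)
        ((eventually_ge_atTop n).mono fun k hk => ?_)
      rw [hpart, hpart]
      exact h n k hk _ (Finset.measurableSet_biUnion _ fun i _ => hf i)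
    refine hunif.tendsto_of_eventually_tendsto (L := fun n => (ν n).real (⋃ i, f i))
      (Eventually.of_forall fun n => ?_) (ha _ (MeasurableSet.iUnion hf))
    have h1 : ∑' i, ν n (f i) = ν n (⋃ i, f i) := (measure_iUnion hd hf).symm
    have h2 := ENNReal.hasSum_toReal (f := fun i => ν n (f i))
      (by rw [h1]; exact measure_ne_top _ _)
    rw [← ENNReal.tsum_toReal_eq fun i => measure_ne_top _ _, h1] at h2
    exact h2.tendsto_sum_nat
  let π : Measure α := Measure.ofMeasurable (fun A _ => ENNReal.ofReal (a A))
    (by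
      have : a ∅ = 0 := tendsto_nhds_unique (ha ∅ MeasurableSet.empty) (by simp)
      simp [this])
    (fun f hf hd => by
      rw [← (hsum f hf hd).tsum_eq, ENNReal.ofReal_tsum_of_nonneg (fun i => ha0 _ (hf i))
        (hsum f hf hd).summable])
  have hπ : ∀ A, MeasurableSet A → π.real A = a A := fun A hA => by
    rw [measureReal_def, Measure.ofMeasurable_apply A hA, ENNReal.toReal_ofReal (ha0 A hA)]
  refine ⟨π, ⟨?_⟩, fun A hA => by rw [hπ A hA]; exact ha A hA⟩
  have hu : a univ = 1 := tendsto_nhds_unique (ha univ MeasurableSet.univ) (by simp)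
  rw [Measure.ofMeasurable_apply _ MeasurableSet.univ, hu, ENNReal.ofReal_one]

/-- Fatou's inequality for setwise convergence. -/
theorem lintegral_le_of_setwise {π : Measure α} [IsFiniteMeasure π] {ν : ℕ → Measure α}
    [∀ n, IsFiniteMeasure (ν n)]
    (h : ∀ A, MeasurableSet A → Tendsto (fun n => (ν n).real A) atTop (𝓝 (π.real A)))
    {f : α → ℝ≥0∞} {c : ℕ → ℝ≥0∞} {b : ℝ≥0∞} (hc : ∀ n, ∫⁻ x, f x ∂ν n ≤ c n)
    (hcb : Tendsto c atTop (𝓝 b)) : ∫⁻ x, f x ∂π ≤ b := by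
  rw [lintegral_eq_nnreal]
  refine iSup₂_le fun φ hφ => ?_
  have hlim : Tendsto (fun n => (φ.map ((↑) : ℝ≥0 → ℝ≥0∞)).lintegral (ν n)) atTop
      (𝓝 ((φ.map ((↑) : ℝ≥0 → ℝ≥0∞)).lintegral π)) := by
    simp_rw [SimpleFunc.map_lintegral]
    refine tendsto_finsetSum _ fun x _ => ENNReal.Tendsto.const_mul ?_ (Or.inr ENNReal.coe_ne_top)
    have := h (φ ⁻¹' {x}) (φ.measurableSet_preimage _)
    simp_rw [measureReal_def] at this
    exact (ENNReal.tendsto_toReal_iff (fun n => measure_ne_top _ _) (measure_ne_top _ _)).1 this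
  refine le_of_tendsto_of_tendsto' hlim hcb fun n => le_trans ?_ (hc n)
  rw [← SimpleFunc.lintegral_eq_lintegral]
  exact lintegral_mono fun x => hφ x

end Setwise

/-! ### The invariant measure -/

section Invariant

variable {d : ℕ} {U : EuclideanSpace ℝ (Fin d) → ℝ} {m L : ℝ}

local notation "E" => EuclideanSpace ℝ (Fin d)

theorem eulerChain_const (U : E → ℝ) (γ : ℝ) (n : ℕ) :
    eulerChain U (fun _ => γ) 1 n = eulerKernel U γ ^ n := by
  induction n with
  | zero => rfl
  | succ n ih =>
    rw [eulerChain_succ_of_le U _ (by omega), ih, pow_succ']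
    rfl

theorem isMarkovKernel_eulerKernel_pow (U : E → ℝ) {γ : ℝ} (hγ : 0 < γ) (n : ℕ) :
    IsMarkovKernel (eulerKernel U γ ^ n) := by
  rw [← eulerChain_const]
  exact isMarkovKernel_eulerChain U (fun _ _ => hγ) 1 n

theorem inv_sqrt_Lam_const {κ γ : ℝ} (hκ : 0 < κ) (hγ : 0 < γ) (hq : 0 ≤ 1 - κ * γ) {n : ℕ}
    (hn : 1 ≤ n) :
    (√(4 * Real.pi * Lam κ (fun _ => γ) 1 n))⁻¹
      = (√(4 * Real.pi * κ⁻¹ * (1 - (1 - κ * γ) ^ n)))⁻¹ * √(1 - κ * γ) ^ n := by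
  have hq1 : 1 - κ * γ < 1 := by linarith [mul_pos hκ hγ]
  rw [Lam, Finset.prod_const, Nat.card_Icc, Nat.add_sub_cancel]
  generalize 1 - κ * γ = q at *
  rcases hq.eq_or_lt with rfl | hq0
  · -- For `q = 0` the left side is `0` because the radicand is negative.
    have hneg : 4 * Real.pi * (κ⁻¹ * ((0 : ℝ)⁻¹ ^ n - 1)) ≤ 0 := by
      rw [inv_zero, zero_pow (by omega), zero_sub, mul_neg_one, mul_neg, neg_nonpos]
      positivity
    rw [Real.sqrt_eq_zero_of_nonpos hneg, Real.sqrt_zero, zero_pow (by omega), mul_zero, inv_zero]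
  · have e : 4 * Real.pi * (κ⁻¹ * (q⁻¹ ^ n - 1))
        = 4 * Real.pi * κ⁻¹ * (1 - q ^ n) / (√q ^ n) ^ 2 := by
      rw [← pow_mul, mul_comm n, pow_mul, Real.sq_sqrt hq0.le, inv_pow]
      field_simp
    rw [e, Real.sqrt_div' _ (by positivity), Real.sqrt_sq (by positivity), inv_div, div_eq_inv_mul]

/-- The Lipschitz constant of `x ↦ R_γ^n(x, A)` for `n ≥ 1`. For `κγ = 1` it is `0`. -/
noncomputable def powConst (κ γ : ℝ) (n : ℕ) : ℝ :=
  (√(4 * Real.pi * κ⁻¹ * (1 - (1 - κ * γ) ^ n)))⁻¹ * √(1 - κ * γ) ^ n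

theorem powConst_nonneg (κ γ : ℝ) (n : ℕ) : 0 ≤ powConst κ γ n := by
  unfold powConst
  positivity

theorem powConst_le {κ γ : ℝ} (hκ : 0 < κ) (hγ : 0 < γ) (hq : 0 ≤ 1 - κ * γ) {n : ℕ}
    (hn : 1 ≤ n) :
    powConst κ γ n ≤ (√(4 * Real.pi * κ⁻¹ * (1 - (1 - κ * γ) ^ ((n : ℝ) / 2))))⁻¹
      * (1 - κ * γ) ^ ((n : ℝ) / 2) := by
  have hq1 : 1 - κ * γ < 1 := by linarith [mul_pos hκ hγ]
  unfold powConst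
  generalize 1 - κ * γ = q at *
  have h1 : q ^ ((n : ℝ) / 2) = √q ^ n := by
    rw [Real.sqrt_eq_rpow, ← Real.rpow_mul_natCast hq]
    congr 1
    ring
  have hs : √q < 1 := by
    rw [Real.sqrt_lt' one_pos]
    linarith
  have hlt : √q ^ n < 1 := pow_lt_one₀ (Real.sqrt_nonneg _) hs (by omega)
  have hle : q ^ n ≤ √q ^ n :=
    pow_le_pow_left₀ hq (Real.le_sqrt_of_sq_le (by nlinarith)) n
  rw [h1]
  have hpos : 0 < 4 * Real.pi * κ⁻¹ * (1 - √q ^ n) :=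
    mul_pos (by positivity) (by linarith)
  gcongr

theorem powConst_le_geometric {κ γ : ℝ} (hκ : 0 < κ) (hγ : 0 < γ) (hq : 0 ≤ 1 - κ * γ) {n : ℕ}
    (hn : 1 ≤ n) :
    powConst κ γ n ≤ (√(4 * Real.pi * γ))⁻¹ * √(1 - κ * γ) ^ n := by
  have hq1 : 1 - κ * γ < 1 := by linarith [mul_pos hκ hγ]
  have h1 : (1 - κ * γ) ^ n ≤ 1 - κ * γ := pow_le_of_le_one hq hq1.le (by omega)
  have h2 : 4 * Real.pi * γ ≤ 4 * Real.pi * κ⁻¹ * (1 - (1 - κ * γ) ^ n) := by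
    calc 4 * Real.pi * γ = 4 * Real.pi * κ⁻¹ * (κ * γ) := by field_simp
      _ ≤ _ := by gcongr; linarith
  unfold powConst
  gcongr

theorem eulerKernel_pow_real_sub_le (hd : 1 ≤ d) (hL : GradientLipschitz U L)
    (hm : StronglyConvex U m) {γ : ℝ} (hγ : 0 < γ) (hγ' : γ ≤ 2 / (m + L)) {n : ℕ} (hn : 1 ≤ n)
    {A : Set E} (hA : MeasurableSet A) (x y : E) :
    |((eulerKernel U γ ^ n) x).real A - ((eulerKernel U γ ^ n) y).real A|
      ≤ powConst (kappa m L) γ n * ‖x - y‖ := by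
  have h := (eulerChain_real_sub_le hd hL hm (γ := fun _ => γ)
    ⟨fun _ _ => hγ, fun _ _ => le_rfl, hγ'⟩ le_rfl hn hA x y).2
  rwa [eulerChain_const, inv_sqrt_Lam_const (kappa_pos hd hL hm) hγ
    (one_sub_kappa_mul_nonneg hd hL hm hγ') hn] at h

/-- The Lipschitz bound integrated: `R_γ^n` from an arbitrary initial law and from a point mass. -/
theorem eulerKernel_pow_comp_real_sub_le (hd : 1 ≤ d) (hL : GradientLipschitz U L)
    (hm : StronglyConvex U m) {γ : ℝ} (hγ : 0 < γ) (hγ' : γ ≤ 2 / (m + L)) {n : ℕ} (hn : 1 ≤ n)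
    {A : Set E} (hA : MeasurableSet A) {μ : Measure E} [IsProbabilityMeasure μ] (x : E) {M : ℝ}
    (hM : 0 ≤ M) (hμ : ∫⁻ y, ENNReal.ofReal ‖y - x‖ ∂μ ≤ ENNReal.ofReal M) :
    |((eulerKernel U γ ^ n : Kernel E E) ∘ₘ μ).real A - ((eulerKernel U γ ^ n) x).real A|
      ≤ powConst (kappa m L) γ n * M := by
  have := isMarkovKernel_eulerKernel_pow U hγ n
  have h0 := powConst_nonneg (kappa m L) γ n
  have h := ofReal_abs_comp_real_sub_le h0 hA
    (eulerKernel_pow_real_sub_le hd hL hm hγ hγ' hn hA) (μ := μ) (ν := Measure.dirac x)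
    (ζ := μ.map fun y => (y, x))
    (by rw [Measure.map_map (by fun_prop) (by fun_prop)]; exact Measure.map_id)
    (by
      rw [Measure.map_map (by fun_prop) (by fun_prop)]
      change μ.map (fun _ => x) = _
      simp)
  rw [Measure.dirac_bind (Kernel.measurable _), lintegral_map (by fun_prop) (by fun_prop)] at h
  have h2 := h.trans (mul_le_mul_right hμ _)
  rw [← ENNReal.ofReal_mul h0] at h2
  exact (ENNReal.ofReal_le_ofReal_iff (by positivity)).1 h2

/-- The chain started at the minimizer has second moment about it at most `2d/κ`: the recursion is
`s ↦ (1 - κγ) s + 2γd`, which has this fixed point. -/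
theorem lintegral_eulerKernel_pow_le (hd : 1 ≤ d) (hL : GradientLipschitz U L)
    (hm : StronglyConvex U m) {γ : ℝ} (hγ : 0 < γ) (hγ' : γ ≤ 2 / (m + L)) {xs : E}
    (hxs : gradient U xs = 0) (n : ℕ) :
    ∫⁻ y, ENNReal.ofReal (‖y - xs‖ ^ 2) ∂((eulerKernel U γ ^ n) xs)
      ≤ ENNReal.ofReal (2 * (kappa m L)⁻¹ * d) := by
  have hκ := kappa_pos hd hL hm
  have hq := one_sub_kappa_mul_nonneg hd hL hm hγ'
  induction n with
  | zero =>
    change ∫⁻ y, _ ∂(Kernel.id xs) ≤ _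
    rw [Kernel.id_apply, lintegral_dirac]
    simp
  | succ n ih =>
    have := isMarkovKernel_eulerKernel_pow U hγ n
    have e : eulerKernel U γ ^ (n + 1) = eulerKernel U γ ∘ₖ (eulerKernel U γ ^ n) := pow_succ' _ _
    rw [e, Kernel.lintegral_comp _ _ _ (by fun_prop)]
    have hpt : ∀ z, ∫⁻ y, ENNReal.ofReal (‖y - xs‖ ^ 2) ∂(eulerKernel U γ z)
        ≤ ENNReal.ofReal (1 - kappa m L * γ) * ENNReal.ofReal (‖z - xs‖ ^ 2)
          + ENNReal.ofReal (2 * γ * d) := by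
      intro z
      have h1 := lintegral_norm_sub_sq (γ := γ.toNNReal) (by simpa using hγ)
        (z - γ • gradient U z) xs
      rw [Real.coe_toNNReal γ hγ.le] at h1
      have h2 := norm_gradient_step_sub_sq_le hd hL hm hγ hγ' z xs
      rw [hxs, smul_zero, sub_zero] at h2
      rw [eulerKernel_apply, h1, ← ENNReal.ofReal_mul hq,
        ← ENNReal.ofReal_add (by positivity) (by positivity)]
      exact ENNReal.ofReal_le_ofReal (by linarith)
    refine (lintegral_mono hpt).trans ?_
    rw [lintegral_add_right _ measurable_const, lintegral_const_mul' _ _ ENNReal.ofReal_ne_top,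
      lintegral_const, measure_univ, mul_one]
    refine (add_le_add_left (mul_le_mul_right ih _) _).trans ?_
    rw [← ENNReal.ofReal_mul hq, ← ENNReal.ofReal_add (by positivity) (by positivity)]
    refine ENNReal.ofReal_le_ofReal (le_of_eq ?_)
    field_simp
    ring

/-- Existence: the laws `R_γ^(n+1)(x⋆, ·)` are Cauchy in total variation, uniformly in the event,
and their limit inherits the second moment bound and is invariant. -/
theorem exists_invariant (hd : 1 ≤ d) (hL : GradientLipschitz U L)
    (hm : StronglyConvex U m) {γ : ℝ} (hγ : 0 < γ) (hγ' : γ ≤ 2 / (m + L)) {xs : E}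
    (hxs : gradient U xs = 0) :
    ∃ π : Measure E, IsProbabilityMeasure π ∧ Kernel.Invariant (eulerKernel U γ) π ∧
      ∫⁻ y, ENNReal.ofReal (‖y - xs‖ ^ 2) ∂π ≤ ENNReal.ofReal (2 * (kappa m L)⁻¹ * d) := by
  have hκ := kappa_pos hd hL hm
  have hq := one_sub_kappa_mul_nonneg hd hL hm hγ'
  have hM := isMarkovKernel_eulerKernel U hγ
  have hMn := isMarkovKernel_eulerKernel_pow U hγ
  have hd' : (0 : ℝ) < d := by exact_mod_cast hd
  set S := 2 * (kappa m L)⁻¹ * (d : ℝ) with hS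
  have hS0 : 0 < S := by positivity
  set ν : ℕ → Measure E := fun n => (eulerKernel U γ ^ (n + 1)) xs with hν
  have hmom : ∀ n, ∫⁻ y, ENNReal.ofReal (‖y - xs‖ ^ 2) ∂ν n ≤ ENNReal.ofReal S := fun n =>
    lintegral_eulerKernel_pow_le hd hL hm hγ hγ' hxs (n + 1)
  set ρ := √(1 - kappa m L * γ) with hρ
  have hρ1 : ρ < 1 := by
    rw [hρ, Real.sqrt_lt' one_pos]
    linarith [mul_pos hκ hγ]
  have hρ0 : 0 ≤ ρ := Real.sqrt_nonneg _
  -- The law after `k + 1` steps is the law after `n + 1` steps from the law after `k - n` steps,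
  -- whose mean distance to `x⋆` is bounded uniformly in `k`.
  have hcauchy : ∀ n k, n ≤ k → ∀ A, MeasurableSet A →
      |(ν n).real A - (ν k).real A| ≤ (√(4 * Real.pi * γ))⁻¹ * ρ ^ (n + 1) * √S := by
    intro n k hnk A hA
    have e : ν k
        = (eulerKernel U γ ^ (n + 1) : Kernel E E) ∘ₘ ((eulerKernel U γ ^ (k - n)) xs) := by
      have : eulerKernel U γ ^ (k + 1) = eulerKernel U γ ^ (n + 1) * eulerKernel U γ ^ (k - n) := by
        rw [← pow_add]
        congr 1
        omega
      simp only [hν, this]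
      exact Kernel.comp_apply _ _ _
    rw [abs_sub_comm, e]
    have hm1 := lintegral_norm_sub_le_sqrt hS0
      (lintegral_eulerKernel_pow_le hd hL hm hγ hγ' hxs (k - n))
    refine (eulerKernel_pow_comp_real_sub_le hd hL hm hγ hγ' (by omega) hA xs
      (Real.sqrt_nonneg S) hm1).trans ?_
    gcongr
    exact powConst_le_geometric hκ hγ hq (by omega)
  have hε : Tendsto (fun n => (√(4 * Real.pi * γ))⁻¹ * ρ ^ (n + 1) * √S) atTop (𝓝 0) := by
    have h1 := (tendsto_add_atTop_iff_nat 1).2 (tendsto_pow_atTop_nhds_zero_of_lt_one hρ0 hρ1)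
    simpa using (h1.const_mul (√(4 * Real.pi * γ))⁻¹).mul_const √S
  obtain ⟨π, hπ, hlim⟩ := exists_setwise_limit ν hε hcauchy
  refine ⟨π, hπ, ?_, lintegral_le_of_setwise hlim hmom tendsto_const_nhds⟩
  have hle : eulerKernel U γ ∘ₘ π ≤ π := by
    refine Measure.le_iff.2 fun A hA => ?_
    rw [Measure.bind_apply hA (Kernel.aemeasurable _)]
    refine lintegral_le_of_setwise hlim (c := fun n => ν (n + 1) A) (fun n => le_of_eq ?_) ?_
    · simp only [hν]
      rw [pow_succ' _ (n + 1)]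
      exact (Kernel.comp_apply' _ _ _ hA).symm
    · have h1 := (tendsto_add_atTop_iff_nat 1).2 (hlim A hA)
      simp_rw [measureReal_def] at h1
      exact (ENNReal.tendsto_toReal_iff (fun n => measure_ne_top _ _) (measure_ne_top _ _)).1 h1
  exact Measure.eq_of_le_of_isProbabilityMeasure hle

theorem invariant_pow {κ : Kernel E E} {π : Measure E} (h : Kernel.Invariant κ π) (n : ℕ) :
    (κ ^ n : Kernel E E) ∘ₘ π = π := by
  induction n with
  | zero => exact Measure.id_comp
  | succ n ih =>
    have e : κ ^ (n + 1) = (κ ^ n) ∘ₖ κ := pow_succ _ _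
    rw [e, ← Measure.comp_assoc, h.def, ih]

theorem invariant_real_sub_le (hd : 1 ≤ d) (hL : GradientLipschitz U L)
    (hm : StronglyConvex U m) {γ : ℝ} (hγ : 0 < γ) (hγ' : γ ≤ 2 / (m + L)) {xs : E}
    {π : Measure E} [IsProbabilityMeasure π] (hπ : Kernel.Invariant (eulerKernel U γ) π)
    (hmom : ∫⁻ y, ENNReal.ofReal (‖y - xs‖ ^ 2) ∂π ≤ ENNReal.ofReal (2 * (kappa m L)⁻¹ * d))
    (x : E) {n : ℕ} (hn : 1 ≤ n) {A : Set E} (hA : MeasurableSet A) :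
    |π.real A - ((eulerKernel U γ ^ n) x).real A|
      ≤ powConst (kappa m L) γ n * (‖x - xs‖ + √(2 * (kappa m L)⁻¹ * d)) := by
  have hκ := kappa_pos hd hL hm
  have hd' : (0 : ℝ) < d := by exact_mod_cast hd
  have h1 := lintegral_norm_sub_le_sqrt (by positivity) hmom
  have h2 : ∫⁻ y, ENNReal.ofReal ‖y - x‖ ∂π
      ≤ ENNReal.ofReal (‖x - xs‖ + √(2 * (kappa m L)⁻¹ * d)) := by
    have hpt : ∀ y, ENNReal.ofReal ‖y - x‖ ≤ ENNReal.ofReal ‖x - xs‖ + ENNReal.ofReal ‖y - xs‖ :=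
      fun y => by
        rw [← ENNReal.ofReal_add (norm_nonneg _) (norm_nonneg _)]
        refine ENNReal.ofReal_le_ofReal ?_
        have := norm_sub_le (y - xs) (x - xs)
        rw [sub_sub_sub_cancel_right] at this
        linarith
    refine (lintegral_mono hpt).trans ?_
    rw [lintegral_add_left measurable_const, lintegral_const, measure_univ, mul_one,
      ENNReal.ofReal_add (norm_nonneg _) (Real.sqrt_nonneg _)]
    gcongr
  have h3 := eulerKernel_pow_comp_real_sub_le hd hL hm hγ hγ' hn hA x (by positivity) h2
  rwa [invariant_pow hπ n] at h3

theorem invariant_unique (hd : 1 ≤ d) (hL : GradientLipschitz U L)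
    (hm : StronglyConvex U m) {γ : ℝ} (hγ : 0 < γ) (hγ' : γ ≤ 2 / (m + L)) {xs : E}
    {π : Measure E} [IsProbabilityMeasure π] (hπ : Kernel.Invariant (eulerKernel U γ) π)
    (hmom : ∫⁻ y, ENNReal.ofReal (‖y - xs‖ ^ 2) ∂π ≤ ENNReal.ofReal (2 * (kappa m L)⁻¹ * d))
    {ρ : Measure E} [IsProbabilityMeasure ρ] (hρ : Kernel.Invariant (eulerKernel U γ) ρ) :
    ρ = π := by
  have hκ := kappa_pos hd hL hm
  have hq := one_sub_kappa_mul_nonneg hd hL hm hγ'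
  have hMn := isMarkovKernel_eulerKernel_pow U hγ
  have hC : Tendsto (fun n => powConst (kappa m L) γ (n + 1)) atTop (𝓝 0) := by
    have hρ1 : √(1 - kappa m L * γ) < 1 := by
      rw [Real.sqrt_lt' one_pos]
      linarith [mul_pos hκ hγ]
    have h1 := (tendsto_add_atTop_iff_nat 1).2
      (tendsto_pow_atTop_nhds_zero_of_lt_one (Real.sqrt_nonneg _) hρ1)
    refine squeeze_zero (fun n => powConst_nonneg _ _ _)
      (fun n => powConst_le_geometric hκ hγ hq (by omega)) ?_
    simpa using h1.const_mul (√(4 * Real.pi * γ))⁻¹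
  ext A hA
  rw [← measureReal_eq_measureReal_iff]
  -- Dominated convergence in `ρ(A) = ∫ R_γ^(n+1)(y, A) ρ(dy)`; no moment of `ρ` is needed.
  have hlim : Tendsto (fun n => ∫ y, ((eulerKernel U γ ^ (n + 1)) y).real A ∂ρ) atTop
      (𝓝 (∫ _, π.real A ∂ρ)) := by
    refine tendsto_integral_of_dominated_convergence (fun _ => 1)
      (fun n => (measurable_kernel_real _ hA).aestronglyMeasurable) (integrable_const _)
      (fun n => Eventually.of_forall fun y => ?_) (Eventually.of_forall fun y => ?_)
    · rw [Real.norm_eq_abs, abs_of_nonneg measureReal_nonneg]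
      exact measureReal_le_one
    · rw [tendsto_iff_dist_tendsto_zero]
      refine squeeze_zero (fun n => dist_nonneg) (fun n => ?_)
        ((hC.mul_const (‖y - xs‖ + √(2 * (kappa m L)⁻¹ * d))).trans_eq (by rw [zero_mul]))
      rw [dist_comm, Real.dist_eq]
      exact invariant_real_sub_le hd hL hm hγ hγ' hπ hmom y (Nat.le_add_left 1 n) hA
  simp_rw [← comp_real_eq_integral _ ρ hA, invariant_pow hρ] at hlim
  simpa using tendsto_nhds_unique tendsto_const_nhds hlim

end Invariant

end ULA

/-- In parts (i) and (ii), if some factor `1 - κ γ_j` vanishes then `Λ_{n,ℓ}(γ) = +∞` and both right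
sides are `0`; here `Lam` is then `-κ⁻¹ < 0`, its square root is `0`, and both right sides are `0` as
well, because division by `0` gives `0`. -/
theorem mainTheorem2 (d : ℕ) (hd : 1 ≤ d) (U : EuclideanSpace ℝ (Fin d) → ℝ) (m L : ℝ)
    (hL : ULA.GradientLipschitz U L) (hm : ULA.StronglyConvex U m) :
    -- (i)
    (∀ γ : ℕ → ℝ, ULA.StepSizes γ (2 / (m + L)) →
      ∀ (x y : EuclideanSpace ℝ (Fin d)) (n ℓ : ℕ), 1 ≤ n → n < ℓ →
        ULA.tvDist (ULA.eulerChain U γ n ℓ ∘ₘ Measure.dirac x)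
            (ULA.eulerChain U γ n ℓ ∘ₘ Measure.dirac y) ≤
          1 - 2 * ULA.Phi (-(‖x - y‖ / √(8 * ULA.Lam (ULA.kappa m L) γ n ℓ)))) ∧
    -- (ii)
    (∀ γ : ℕ → ℝ, ULA.StepSizes γ (2 / (m + L)) →
      ∀ μ ν : Measure (EuclideanSpace ℝ (Fin d)), ULA.InP1 μ → ULA.InP1 ν →
        ∀ n ℓ : ℕ, 1 ≤ n → n < ℓ →
          ULA.tvDist (ULA.eulerChain U γ n ℓ ∘ₘ μ) (ULA.eulerChain U γ n ℓ ∘ₘ ν) ≤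
            (√(4 * Real.pi * ULA.Lam (ULA.kappa m L) γ n ℓ))⁻¹ * ULA.W1 μ ν) ∧
    -- (iii)
    (∃ xstar : EuclideanSpace ℝ (Fin d),
      (∀ y, U xstar ≤ U y) ∧ (∀ z, (∀ y, U z ≤ U y) → z = xstar) ∧
      ∀ γ : ℝ, 0 < γ → γ ≤ 2 / (m + L) →
        ∃ πγ : Measure (EuclideanSpace ℝ (Fin d)),
          (IsProbabilityMeasure πγ ∧ Kernel.Invariant (ULA.eulerKernel U γ) πγ) ∧
          (∀ ρ : Measure (EuclideanSpace ℝ (Fin d)), IsProbabilityMeasure ρ →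
            Kernel.Invariant (ULA.eulerKernel U γ) ρ → ρ = πγ) ∧
          ∀ (x : EuclideanSpace ℝ (Fin d)) (n : ℕ), 1 ≤ n →
            ULA.tvDist πγ ((ULA.eulerKernel U γ ^ n : Kernel _ _) ∘ₘ Measure.dirac x) ≤
              (√(4 * Real.pi * (ULA.kappa m L)⁻¹ *
                  (1 - (1 - ULA.kappa m L * γ) ^ ((n : ℝ) / 2))))⁻¹ *
                (1 - ULA.kappa m L * γ) ^ ((n : ℝ) / 2) *
                (‖x - xstar‖ + √(2 * (ULA.kappa m L)⁻¹ * d))) := by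
  refine ⟨fun γ hγ x y n ℓ hn hnl => ?_, fun γ hγ μ ν hμ hν n ℓ hn hnl => ?_, ?_⟩
  · rw [Measure.dirac_bind (Kernel.measurable _), Measure.dirac_bind (Kernel.measurable _)]
    exact ULA.tvDist_le fun A hA =>
      (ULA.eulerChain_real_sub_le hd hL hm hγ hn hnl.le hA x y).1
  · have := ULA.isMarkovKernel_eulerChain U hγ.1 n ℓ
    exact ULA.tvDist_comp_le_W1 (by positivity)
      (fun A hA x y => (ULA.eulerChain_real_sub_le hd hL hm hγ hn hnl.le hA x y).2) hμ hν
  · obtain ⟨xs, hxs, huniq⟩ := ULA.existsUnique_minimizer hL hm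
    refine ⟨xs, hxs, huniq, fun γ hγ hγ' => ?_⟩
    obtain ⟨π, hπ, hinv, hmom⟩ :=
      ULA.exists_invariant hd hL hm hγ hγ' (ULA.gradient_eq_zero_of_forall_le hxs)
    refine ⟨π, ⟨hπ, hinv⟩, fun ρ _ hρinv =>
      ULA.invariant_unique hd hL hm hγ hγ' hinv hmom hρinv, fun x n hn => ?_⟩
    rw [Measure.dirac_bind (Kernel.measurable _)]
    refine ULA.tvDist_le fun A hA =>
      (ULA.invariant_real_sub_le hd hL hm hγ hγ' hinv hmom x hn hA).trans ?_
    gcongr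
    exact ULA.powConst_le (ULA.kappa_pos hd hL hm) hγ
      (ULA.one_sub_kappa_mul_nonneg hd hL hm hγ') hn
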